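/- **Setting.** Let $I=(a,b)$ be a bounded open interval, $\alpha>0$, $\beta\ge 0$, $g\in L^\infty(I)$. A function $u\in L^1(I)$ is in $SBV(I)$ if its distributional derivative is a finite measure without Cantor part, $Du=u'\,dx+\sum_{x}h(x)\delta_x$ with $u'\in L^1(I)$ and $\sum_x|h(x)|<\infty$. Let $u^l(x),u^r(x)$ be the left and right traces of $u$ at $x\in I$, $S_u=\{x\in I: u^l(x)\ne u^r(x)\}$ its jump set, and $u^-=\min(u^l,u^r)$, $u^+=\max(u^l,u^r)$. The extended graph $$\Gamma_u=\{(x,t)\in I\times\mathbb R: u^-(x)\le t\le u^+(x)\}$$ is $1$-rectifiable; it is oriented by the unit tangent $\xi_u=(1,u')/\sqrt{1+(u')^2}$ over $I\setminus S_u$ and $\xi_u=(0,\operatorname{sign}(u^r-u^l))$ over $S_u$, and $\Gamma_u$ also denotes the current $\Gamma_u(\omega)=\int_{\Gamma_u}\langle\omega,\xi_u\rangle\,d\mathcal H^1$ acting on smooth $1$-forms $\omega$ with compact support in $I\times\mathbb R$. Let $K$ be the set of Borel vector fields $\phi=(\phi^x,\phi^t):I\times\mathbb R\to\mathbb R^2$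 such that, for all $x\in I$ and $t,t_1,t_2\in\mathbb R$, $$\phi^t(x,t)\ge\frac{|\phi^x(x,t)|^2}{4}-\beta\,(t-g(x))^2\qquad\text{and}\qquad\left|\int_{t_1}^{t_2}\phi^x(x,s)\,ds\right|\le\alpha .$$ For a $1$-dimensional rectifiable current with real multiplicity $T=(\mathcal M,\theta,\xi)$ in $I\times\mathbb R$, that is $T(\omega)=\int_{\mathcal M}\theta\,\langle\omega,\xi\rangle\,d\mathcal H^1$, put $\nu_T=-\star\xi$, where $\star$ is the Hodge star, $\star(\xi^x,\xi^t)=(-\xi^t,\xi^x)$, and $$G(T)=\sup_{\phi\in K}\int_{\mathcal M}\theta\,\langle\phi,\nu_T\rangle\,d\mathcal H^1\in[0,+\infty],$$ the supremum being over those $\phi\in K$ for which the integrand is integrable. The value $G(T)$ depends only on the current $T$, not on the triple that represents it. **Theorem (Convex decomposition formula).** Let $k\in\mathbb N$, $\lambda_1,\dots,\lambda_k\ge 0$ and $u_1,\dots,u_k\in SBV(I)$ be such that $S_T:=\bigcup_{i=1}^k S_{u_i}$ is a finite set, and let $T=\sum_{i=1}^k\lambda_i\Gamma_{u_i}$. Then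 there exist $k'\in\mathbb N$, $\mu_1,\dots,\mu_{k'}>0$ and $w_1,\dots,w_{k'}\in SBV(I)$ such that $$T=\sum_{i=1}^{k'}\mu_i\Gamma_{w_i}\qquad\text{and}\qquad G(T)=\sum_{i=1}^{k'}\mu_i\,G(\Gamma_{w_i}),$$ where the last identity holds in $[0,+\infty]$, and empty sums are $0$. -/

import Mathlib

noncomputable section

open MeasureTheory Measure Set Filter Topology
open scoped Distributions NNReal ENNReal

namespace MumfordShah

/-! ### SBV functions on the interval `I = (a, b)` -/

/-- The open interval `(a, b)`, as a bundled open set. -/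
def interval (a b : ℝ) : TopologicalSpace.Opens ℝ := ⟨Ioo a b, isOpen_Ioo⟩

/-- `u ∈ SBV(I)`: `u ∈ L¹(I)` and its distributional derivative is a finite measure without Cantor
part, i.e. the sum of an absolutely continuous measure `v dx` with `v ∈ L¹(I)` and of a finite
purely atomic measure `∑ₓ h(x) δₓ`. Only the values of `u` on `I`, up to null sets, matter. -/
def IsSBV (a b : ℝ) (u : ℝ → ℝ) : Prop :=
  IntegrableOn u (Ioo a b) ∧
  ∃ (v : ℝ → ℝ) (h : Ioo a b → ℝ), IntegrableOn v (Ioo a b) ∧ Summable h ∧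
    ∀ ψ : 𝓓(interval a b, ℝ),
      ∫ x in Ioo a b, u x * deriv ψ x = -((∫ x in Ioo a b, v x * ψ x) + ∑' x, h x * ψ x)

/-- The left trace `u^l(x)`. -/
def leftTrace (u : ℝ → ℝ) (x : ℝ) : ℝ :=
  limUnder (𝓝[>] (0 : ℝ)) fun r => ⨍ y in Ioo (x - r) x, u y

/-- The right trace `u^r(x)`. -/
def rightTrace (u : ℝ → ℝ) (x : ℝ) : ℝ :=
  limUnder (𝓝[>] (0 : ℝ)) fun r => ⨍ y in Ioo x (x + r), u y

/-- The singular set `S_u`. -/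
def jumpSet (a b : ℝ) (u : ℝ → ℝ) : Set ℝ :=
  {x | x ∈ Ioo a b ∧ leftTrace u x ≠ rightTrace u x}

/-- The precise representative of `u`. -/
def preciseRep (u : ℝ → ℝ) (x : ℝ) : ℝ := (leftTrace u x + rightTrace u x) / 2

/-- The derivative `u'`: for `u ∈ SBV(I)` the precise representative is differentiable almost
everywhere on `I`, and its derivative is the density of the absolutely continuous part of the
distributional derivative. -/
def apDeriv (u : ℝ → ℝ) : ℝ → ℝ := deriv (preciseRep u)

/-! ### One-dimensional rectifiable currents in `I × ℝ` -/

/-- The plane with its Euclidean metric; a point `(x, t)` has `x = p 0` and `t = p 1`. -/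
abbrev Plane : Type := EuclideanSpace ℝ (Fin 2)

/-- The open strip `I × ℝ`. -/
def strip (a b : ℝ) : TopologicalSpace.Opens Plane :=
  ⟨{p | p 0 ∈ Ioo a b}, isOpen_Ioo.preimage (by fun_prop)⟩

/-- Smooth `1`-forms with compact support in `I × ℝ`. -/
abbrev TestForm (a b : ℝ) : Type := 𝓓(strip a b, Plane →L[ℝ] ℝ)

/-- Functionals on test forms. Currents are compared, added and multiplied by scalars through
their action on test forms. -/
abbrev Functional (a b : ℝ) : Type := TestForm a b → ℝ

/-- The Hodge star on vectors of the plane: `⋆e₁ = e₂`, `⋆e₂ = -e₁`. -/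
def hodge (ξ : Plane) : Plane := !₂[-ξ 1, ξ 0]

/-- `M` is countably `1`-rectifiable: up to an `ℋ¹`-null set, it is covered by countably many
Lipschitz images of subsets of the line. -/
def IsCountablyRectifiable (M : Set Plane) : Prop :=
  ∃ (f : ℕ → ℝ → Plane) (s : ℕ → Set ℝ) (C : ℕ → ℝ≥0),
    (∀ n, LipschitzOnWith (C n) (f n) (s n)) ∧ μH[1] (M \ ⋃ n, f n '' s n) = 0

/-- `ξ` spans the approximate tangent line of `M` at `ℋ¹`-almost every point of the (countably
`1`-rectifiable) set `M`: every Lipschitz curve has, at almost all times that it spends in `M`,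
velocity parallel to `ξ`. -/
def IsTangentTo (M : Set Plane) (ξ : Plane → Plane) : Prop :=
  ∀ (C : ℝ≥0) (γ : ℝ → Plane), LipschitzWith C γ →
    ∀ᵐ s : ℝ, γ s ∈ M → ∃ c : ℝ, deriv γ s = c • ξ (γ s)

/-- A `1`-dimensional rectifiable current with real multiplicity in `I × ℝ`, given by a triple
`(M, θ, ξ)`. -/
structure RectTriple (a b : ℝ) where
  /-- the carrier -/
  M : Set Plane
  /-- the multiplicity -/
  θ : Plane → ℝ
  /-- the orientation -/
  ξ : Plane → Plane
  subset_strip : M ⊆ strip a b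
  measurableSet_M : MeasurableSet M
  rectifiable : IsCountablyRectifiable M
  measurable_θ : Measurable θ
  θ_pos : ∀ p ∈ M, 0 < θ p
  integrable_θ : ∀ Q : Set Plane, IsCompact Q → Q ⊆ strip a b → IntegrableOn θ (M ∩ Q) μH[1]
  measurable_ξ : Measurable ξ
  norm_ξ : ∀ p ∈ M, ‖ξ p‖ = 1
  tangent : IsTangentTo M ξ

/-- The action of the current `(M, θ, ξ)` on test forms. -/
def RectTriple.action {a b : ℝ} (R : RectTriple a b) : Functional a b :=
  fun ω => ∫ p in R.M, R.θ p * ω p (R.ξ p) ∂μH[1]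

/-- The normal `ν_T = -⋆ξ`. -/
def RectTriple.normal {a b : ℝ} (R : RectTriple a b) (p : Plane) : Plane := -hodge (R.ξ p)

/-! ### Extended graphs -/

/-- The extended graph `{(x, t) ∈ I × ℝ : u⁻(x) ≤ t ≤ u⁺(x)}`, where `u⁻` and `u⁺` are the smaller
and the larger of the two traces. -/
def extGraph (a b : ℝ) (u : ℝ → ℝ) : Set Plane :=
  {p | p 0 ∈ Ioo a b ∧ min (leftTrace u (p 0)) (rightTrace u (p 0)) ≤ p 1 ∧
    p 1 ≤ max (leftTrace u (p 0)) (rightTrace u (p 0))}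

/-- The unit tangent vector of the extended graph, which is traversed from left to right, the
vertical segment over a jump point being traversed from the left to the right trace. -/
def graphOrientation (u : ℝ → ℝ) (p : Plane) : Plane :=
  if leftTrace u (p 0) = rightTrace u (p 0) then
    (√(1 + apDeriv u (p 0) ^ 2))⁻¹ • !₂[1, apDeriv u (p 0)]
  else !₂[0, SignType.sign (rightTrace u (p 0) - leftTrace u (p 0))]

/-- The current `Γ_u` carried by the extended graph of `u`, with multiplicity one. -/
def graphCurrent (a b : ℝ) (u : ℝ → ℝ) : Functional a b :=
  fun ω => ∫ p in extGraph a b u, ω p (graphOrientation u p) ∂μH[1]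

/-! ### The lifted functional -/

/-- The set `K` of Borel vector fields `φ = (φˣ, φᵗ)` on `I × ℝ` with
`φᵗ(x, t) ≥ φˣ(x, t)² / 4 - β (t - g(x))²` and `|∫_{t₁}^{t₂} φˣ(x, t) dt| ≤ α` everywhere; the
second condition includes that the integral exists. -/
def fieldSet (a b α β : ℝ) (g : ℝ → ℝ) : Set (Plane → Plane) :=
  {φ | Measurable φ ∧
    (∀ x ∈ Ioo a b, ∀ t : ℝ,
      (φ !₂[x, t] 0) ^ 2 / 4 - β * (t - g x) ^ 2 ≤ φ !₂[x, t] 1) ∧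
    (∀ x ∈ Ioo a b, ∀ t₁ t₂ : ℝ,
      IntervalIntegrable (fun t => φ !₂[x, t] 0) volume t₁ t₂ ∧
      |∫ t in t₁..t₂, φ !₂[x, t] 0| ≤ α)}

/-- `sup_{φ ∈ K} ∫_M θ ⟨φ, ν_T⟩ dℋ¹`, the supremum being over the `φ ∈ K` for which the integral
exists. -/
def RectTriple.lift {a b : ℝ} (α β : ℝ) (g : ℝ → ℝ) (R : RectTriple a b) : EReal :=
  ⨆ φ ∈ {φ ∈ fieldSet a b α β g |
      IntegrableOn (fun p => R.θ p * inner ℝ (φ p) (R.normal p)) R.M μH[1]},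
    ((∫ p in R.M, R.θ p * inner ℝ (φ p) (R.normal p) ∂μH[1] : ℝ) : EReal)

/-- The lifted functional `G`, as a function of the current `T` itself: its value on a triple
`(M, θ, ξ)` that defines `T`. All triples that define the same current give the same value, so the
supremum over them only serves to pick this value. -/
def G {a b : ℝ} (α β : ℝ) (g : ℝ → ℝ) (T : Functional a b) : EReal :=
  ⨆ R ∈ {R : RectTriple a b | R.action = T}, R.lift α β g

end MumfordShah

end

noncomputable section

open MeasureTheory Measure Set Filter Topology
open scoped Distributions NNReal ENNReal

namespace MumfordShah

/-! ### Traces -/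

/-! Write `S` for the finite set of all jump points. On each component of `I \ S` the branches `u i`
are absolutely continuous, and a choice of one branch per component (a path `σ`) pastes them into a
function with jumps in `S` only. Nonnegative weights `P` on paths whose marginal on every component
is `c` reproduce the current. Away from `S` this is the marginal condition itself. Over `y ∈ S` the
density of an extended graph at height `t` is `1_{l < t} - 1_{r < t}`, with `l`, `r` the two traces;
the left and the right component enter separately, so only the marginals matter
(`sumField_paste_ae_eq`). The freedom is thus in the coupling `P`.

Choose `P` minimizing the weighted number of jumps, which is possible by compactness. Suppose two
charged paths jump at `y`, one leaving the height at which the other arrives. Exchanging their tails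
after `y` preserves the marginals and removes at least one of the two jumps, a contradiction. So at
each `y` departure heights and arrival heights are disjoint (`exists_pathWeights_no_chain`).

The lift is evaluated by duality. For any weighted family, the Young inequality on the regular part
and the bound `α` on each jump give `G ≤ ∑ m i * MS(w i)`, with `MS` the Mumford-Shah energy
(`fieldLift_le`). For the converse one field must be almost optimal for all graphs at once
(`le_fieldLift`). Where graphs meet they almost always have the same slope, so a common slope `q`
exists on their union, and `φ = (2q, q² - β(t - g)²)` gives equality there. On the line over `y`
take `φˣ = α ψ'`, with `ψ = 0` at departure heights and `ψ = 1` at arrival heights: disjointness is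
exactly what makes `ψ` available. A single graph satisfies disjointness trivially, so `G(Γ_w) =
MS(w)`, and the two evaluations combine to the formula.

Two preliminaries support this: `SBV` functions with finitely many jumps are piecewise absolutely
continuous (`IsSBV.exists_leftRep`), and the current determines its vector density `θ ξ 1_M` up to
`ℋ¹`-null sets, so `G` can be computed from any representing triple (`G_eq_fieldLift`). -/

theorem tendsto_setAverage {u : ℝ → ℝ} {s : ℝ → Set ℝ} {l : Filter ℝ} {L : ℝ}
    (h : ∀ ε > 0, ∀ᶠ r in l, volume (s r) ≠ 0 ∧ volume (s r) ≠ ∞ ∧ IntegrableOn u (s r) ∧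
      ∀ᵐ y ∂volume.restrict (s r), u y ∈ Metric.closedBall L ε) :
    Tendsto (fun r => ⨍ y in s r, u y) l (𝓝 L) := by
  rw [Metric.nhds_basis_closedBall.tendsto_right_iff]
  intro ε hε
  filter_upwards [h ε hε] with r ⟨h0, h1, h2, h3⟩
  exact (convex_closedBall L ε).set_average_mem Metric.isClosed_closedBall h0 h1 h3 h2

/-- Traces are limits of averages, hence blind to null sets: any almost everywhere representative
with a one-sided limit computes them. -/
theorem leftTrace_eq_of_tendsto {u f : ℝ → ℝ} {c x L : ℝ} (hc : c < x)
    (hu : IntegrableOn u (Ioo c x)) (hae : ∀ᵐ y ∂volume.restrict (Ioo c x), u y = f y)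
    (hf : Tendsto f (𝓝[<] x) (𝓝 L)) : leftTrace u x = L := by
  refine Tendsto.limUnder_eq (tendsto_setAverage fun ε hε => ?_)
  obtain ⟨d, hd, hsub⟩ := (mem_nhdsLT_iff_exists_Ioo_subset' hc).1
    (hf (Metric.closedBall_mem_nhds L hε))
  have hpos : (0 : ℝ) < min (x - c) (x - d) := lt_min (sub_pos.2 hc) (sub_pos.2 hd)
  filter_upwards [Ioo_mem_nhdsGT hpos] with r hr
  have hrc : c < x - r := by linarith [hr.2.trans_le (min_le_left (x - c) (x - d))]
  have hrd : d < x - r := by linarith [hr.2.trans_le (min_le_right (x - c) (x - d))]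
  have hs : Ioo (x - r) x ⊆ Ioo c x := Ioo_subset_Ioo_left hrc.le
  refine ⟨by simp [hr.1], by simp, hu.mono_set hs, ?_⟩
  filter_upwards [ae_restrict_of_ae_restrict_of_subset hs hae,
    ae_restrict_mem measurableSet_Ioo] with y hy hmem
  rw [hy]
  exact hsub ⟨hrd.trans hmem.1, hmem.2⟩

theorem rightTrace_eq_of_tendsto {u f : ℝ → ℝ} {c x L : ℝ} (hc : x < c)
    (hu : IntegrableOn u (Ioo x c)) (hae : ∀ᵐ y ∂volume.restrict (Ioo x c), u y = f y)
    (hf : Tendsto f (𝓝[>] x) (𝓝 L)) : rightTrace u x = L := by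
  refine Tendsto.limUnder_eq (tendsto_setAverage fun ε hε => ?_)
  obtain ⟨d, hd, hsub⟩ := (mem_nhdsGT_iff_exists_Ioo_subset' hc).1
    (hf (Metric.closedBall_mem_nhds L hε))
  have hpos : (0 : ℝ) < min (c - x) (d - x) := lt_min (sub_pos.2 hc) (sub_pos.2 hd)
  filter_upwards [Ioo_mem_nhdsGT hpos] with r hr
  have hrc : x + r < c := by linarith [hr.2.trans_le (min_le_left (c - x) (d - x))]
  have hrd : x + r < d := by linarith [hr.2.trans_le (min_le_right (c - x) (d - x))]
  have hs : Ioo x (x + r) ⊆ Ioo x c := Ioo_subset_Ioo_right hrc.le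
  refine ⟨by simp [hr.1], by simp, hu.mono_set hs, ?_⟩
  filter_upwards [ae_restrict_of_ae_restrict_of_subset hs hae,
    ae_restrict_mem measurableSet_Ioo] with y hy hmem
  rw [hy]
  exact hsub ⟨hmem.1, hmem.2.trans hrd⟩

theorem leftTrace_congr {u w : ℝ → ℝ} {c x : ℝ} (hc : c < x) (h : EqOn u w (Ioo c x)) :
    leftTrace u x = leftTrace w x := by
  unfold leftTrace limUnder
  congr 1
  refine Filter.map_congr ?_
  filter_upwards [Ioo_mem_nhdsGT (sub_pos.2 hc)] with r hr
  refine setAverage_congr_fun measurableSet_Ioo (Eventually.of_forall fun y hy => h ⟨?_, hy.2⟩)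
  linarith [hy.1, hr.2]

theorem rightTrace_congr {u w : ℝ → ℝ} {c x : ℝ} (hc : x < c) (h : EqOn u w (Ioo x c)) :
    rightTrace u x = rightTrace w x := by
  unfold rightTrace limUnder
  congr 1
  refine Filter.map_congr ?_
  filter_upwards [Ioo_mem_nhdsGT (sub_pos.2 hc)] with r hr
  refine setAverage_congr_fun measurableSet_Ioo (Eventually.of_forall fun y hy => h ⟨hy.1, ?_⟩)
  linarith [hy.2, hr.2]

/-! ### Integration by parts against test functions -/

theorem testFunction_eq_zero_of_notMem {a b : ℝ} (ψ : 𝓓(interval a b, ℝ)) {x : ℝ}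
    (hx : x ∉ Ioo a b) : ψ x = 0 :=
  image_eq_zero_of_notMem_tsupport fun h => hx (ψ.tsupport_subset h)

theorem contDiff_testFunction {a b : ℝ} (ψ : 𝓓(interval a b, ℝ)) : ContDiff ℝ 1 ψ :=
  ψ.contDiff.of_le (by exact_mod_cast le_top)

theorem hasDerivAt_testFunction {a b : ℝ} (ψ : 𝓓(interval a b, ℝ)) (x : ℝ) :
    HasDerivAt ψ (deriv ψ x) x :=
  ((contDiff_testFunction ψ).differentiable one_ne_zero x).hasDerivAt

theorem continuous_deriv_testFunction {a b : ℝ} (ψ : 𝓓(interval a b, ℝ)) :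
    Continuous (deriv ψ) :=
  (contDiff_testFunction ψ).continuous_deriv le_rfl

theorem exists_bound_deriv_testFunction {a b : ℝ} (ψ : 𝓓(interval a b, ℝ)) :
    ∃ B, ∀ x, ‖deriv ψ x‖ ≤ B :=
  ψ.hasCompactSupport.deriv.exists_bound_of_continuous (continuous_deriv_testFunction ψ)

theorem integrableOn_mul_deriv_testFunction {a b : ℝ} {f : ℝ → ℝ} (hf : IntegrableOn f (Ioo a b))
    (ψ : 𝓓(interval a b, ℝ)) : IntegrableOn (fun x => f x * deriv ψ x) (Ioo a b) := by
  obtain ⟨B, hB⟩ := exists_bound_deriv_testFunction ψ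
  exact Integrable.mul_bdd hf (continuous_deriv_testFunction ψ).aestronglyMeasurable
    (Eventually.of_forall hB)

theorem integral_primitive_mul_deriv {a b : ℝ} (hab : a < b) {v : ℝ → ℝ}
    (hv : IntegrableOn v (Ioo a b)) (ψ : 𝓓(interval a b, ℝ)) :
    ∫ x in Ioo a b, (∫ t in a..x, v t) * deriv ψ x = -∫ x in Ioo a b, v x * ψ x := by
  have hvi : IntervalIntegrable v volume a b := by
    rwa [intervalIntegrable_iff_integrableOn_Ioo_of_le hab.le]
  have hf := hvi.absolutelyContinuousOnInterval_intervalIntegral (c := a) (by simp)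
  have hψ : AbsolutelyContinuousOnInterval ψ a b :=
    ((contDiff_testFunction ψ).contDiffOn).absolutelyContinuousOnInterval
  have := hf.integral_mul_deriv_eq_deriv_mul hψ
  rw [testFunction_eq_zero_of_notMem ψ (x := a) (by simp),
    testFunction_eq_zero_of_notMem ψ (x := b) (by simp), mul_zero, mul_zero, sub_zero,
    zero_sub, intervalIntegral.integral_of_le hab.le, intervalIntegral.integral_of_le hab.le,
    integral_Ioc_eq_integral_Ioo, integral_Ioc_eq_integral_Ioo] at this
  rw [this]
  congr 1
  refine setIntegral_congr_ae measurableSet_Ioo ?_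
  filter_upwards [hvi.ae_hasDerivAt_integral] with x hx hmem
  rw [uIcc_of_le hab.le] at hx
  rw [(hx (Ioo_subset_Icc_self hmem) a (by simp [hab.le])).deriv]

theorem integral_step_mul_deriv {a b y : ℝ} (hy : y ∈ Ioo a b) (ψ : 𝓓(interval a b, ℝ)) :
    ∫ x in Ioo a b, (if y < x then 1 else 0) * deriv ψ x = -ψ y := by
  have h1 : ∀ x, (if y < x then (1 : ℝ) else 0) * deriv ψ x = (Ioi y).indicator (deriv ψ) x := by
    intro x; by_cases h : y < x <;> simp [h]
  simp_rw [h1]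
  rw [setIntegral_indicator measurableSet_Ioi]
  have h2 : Ioo a b ∩ Ioi y = Ioo y b := by
    ext x; simp only [mem_inter_iff, mem_Ioo, mem_Ioi]
    exact ⟨fun h => ⟨h.2, h.1.2⟩, fun h => ⟨⟨hy.1.trans h.1, h.2⟩, h.1⟩⟩
  rw [h2, ← integral_Ioc_eq_integral_Ioo, ← intervalIntegral.integral_of_le hy.2.le,
    intervalIntegral.integral_eq_sub_of_hasDerivAt (fun x _ => hasDerivAt_testFunction ψ x)
      ((continuous_deriv_testFunction ψ).intervalIntegrable _ _),
    testFunction_eq_zero_of_notMem ψ (x := b) (by simp), zero_sub]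

theorem integral_deriv_testFunction {a b : ℝ} (hab : a < b) (ψ : 𝓓(interval a b, ℝ)) :
    ∫ x in Ioo a b, deriv ψ x = 0 := by
  rw [← integral_Ioc_eq_integral_Ioo, ← intervalIntegral.integral_of_le hab.le,
    intervalIntegral.integral_eq_sub_of_hasDerivAt (fun x _ => hasDerivAt_testFunction ψ x)
      ((continuous_deriv_testFunction ψ).intervalIntegrable _ _),
    testFunction_eq_zero_of_notMem ψ (x := b) (by simp),
    testFunction_eq_zero_of_notMem ψ (x := a) (by simp), sub_zero]

/-- The left-continuous pure jump function with jumps `h`. -/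
def jumpSum {a b : ℝ} (h : Ioo a b → ℝ) (x : ℝ) : ℝ :=
  ∑' y : Ioo a b, if (y : ℝ) < x then h y else 0

theorem norm_ite_le {p : Prop} [Decidable p] (c : ℝ) : ‖if p then c else 0‖ ≤ ‖c‖ := by
  split_ifs <;> simp

theorem measurable_jumpSum {a b : ℝ} {h : Ioo a b → ℝ} (hh : Summable h) :
    Measurable (jumpSum h) := by
  have h1 : ∀ (k : Ioo a b → ℝ), (∀ y, 0 ≤ k y) → Summable k → Measurable (jumpSum k) := by
    intro k hk hks
    refine Monotone.measurable fun x x' hx => ?_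
    have hs : ∀ z : ℝ, Summable fun y : Ioo a b => if (y : ℝ) < z then k y else 0 := fun z =>
      Summable.of_norm_bounded hks.norm fun y => norm_ite_le _
    refine (hs x).tsum_le_tsum (fun y => ?_) (hs x')
    by_cases hy : (y : ℝ) < x
    · simp [hy, hy.trans_le hx]
    · rw [if_neg hy]; split_ifs <;> simp [hk y]
  -- Both `|h|` and `|h| - h` are nonnegative, so the two jump functions are monotone and therefore
  -- measurable.
  have h2 : jumpSum h = fun x => jumpSum (fun y => |h y|) x - jumpSum (fun y => |h y| - h y) x := by
    funext x
    unfold jumpSum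
    rw [← Summable.tsum_sub]
    · refine tsum_congr fun y => ?_
      split_ifs <;> ring
    · exact Summable.of_norm_bounded hh.norm fun y => (norm_ite_le _).trans (by simp)
    · exact Summable.of_norm_bounded (hh.abs.sub hh).norm fun y => norm_ite_le _
  rw [h2]
  exact (h1 _ (fun y => abs_nonneg _) hh.abs).sub
    (h1 _ (fun y => sub_nonneg.2 (le_abs_self _)) (hh.abs.sub hh))

theorem norm_jumpSum_le {a b : ℝ} {h : Ioo a b → ℝ} (hh : Summable h) (x : ℝ) :
    ‖jumpSum h x‖ ≤ ∑' y, ‖h y‖ :=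
  tsum_of_norm_bounded hh.norm.hasSum fun _ => norm_ite_le _

theorem integrableOn_jumpSum {a b : ℝ} {h : Ioo a b → ℝ} (hh : Summable h) :
    IntegrableOn (jumpSum h) (Ioo a b) :=
  Measure.integrableOn_of_bounded (by simp) (measurable_jumpSum hh).aestronglyMeasurable
    (Eventually.of_forall (norm_jumpSum_le hh))

theorem integral_jumpSum_mul_deriv {a b : ℝ} {h : Ioo a b → ℝ} (hh : Summable h)
    (ψ : 𝓓(interval a b, ℝ)) :
    ∫ x in Ioo a b, jumpSum h x * deriv ψ x = -∑' y : Ioo a b, h y * ψ y := by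
  obtain ⟨B, hB⟩ := exists_bound_deriv_testFunction ψ
  let F : Ioo a b → ℝ → ℝ := fun y x => (if (y : ℝ) < x then h y else 0) * deriv ψ x
  have hFint : ∀ y, IntegrableOn (F y) (Ioo a b) := fun y =>
    integrableOn_mul_deriv_testFunction (f := fun x => if (y : ℝ) < x then h y else 0)
      (Measure.integrableOn_of_bounded (M := ‖h y‖) (by simp)
        (Measurable.ite measurableSet_Ioi measurable_const measurable_const).aestronglyMeasurable
        (Eventually.of_forall fun x => norm_ite_le _)) ψ
  have hval : ∀ y : Ioo a b, ∫ x in Ioo a b, F y x = -(h y * ψ y) := by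
    intro y
    have : ∀ x, F y x = h y * ((if (y : ℝ) < x then 1 else 0) * deriv ψ x) := by
      intro x; simp only [F]; split_ifs <;> ring
    simp_rw [this]
    rw [integral_const_mul, integral_step_mul_deriv y.2, mul_neg]
  -- The index set is uncountable. Summability makes the support of `h` countable, so the
  -- interchange of sum and integral is done over that support.
  have hcount' : ∀ y ∉ Function.support h, F y = 0 := by
    intro y hy
    have : h y = 0 := by simpa using hy
    funext x; simp [F, this]
  have hcs : Countable (Function.support h) := hh.countable_support
  have key := integral_tsum_of_summable_integral_norm (μ := volume.restrict (Ioo a b))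
    (F := fun y : Function.support h => F y) (fun y => hFint y) (by
      refine Summable.of_nonneg_of_le (fun y => integral_nonneg fun x => norm_nonneg _)
        (fun y => ?_)
        (((hh.norm.mul_right (B * (volume.real (Ioo a b))))).subtype (Function.support h))
      have : ∫ x in Ioo a b, ‖F y x‖ ≤ ∫ x in Ioo a b, ‖h y‖ * B := by
        refine integral_mono (hFint y).norm (integrable_const _) fun x => ?_
        simp only [F, norm_mul]
        exact mul_le_mul (norm_ite_le _) (hB x) (norm_nonneg _) (norm_nonneg _)
      refine this.trans (le_of_eq ?_)
      simp [mul_comm, mul_assoc, mul_left_comm])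
  have hsum : ∀ x, jumpSum h x * deriv ψ x = ∑' y : Function.support h, F y x := by
    intro x
    rw [jumpSum, ← tsum_mul_right, tsum_subtype_eq_of_support_subset (f := fun y => F y x)]
    intro y hy
    by_contra hy'
    exact hy (congrFun (hcount' y hy') x)
  simp_rw [hsum]
  rw [← key]
  simp_rw [hval]
  rw [tsum_neg, tsum_subtype_eq_of_support_subset (f := fun y => h y * ψ y)]
  exact fun y hy => left_ne_zero_of_mul hy

/-! ### The lemma of du Bois-Reymond -/

/-- The primitive started at the left end of the support vanishes to the left of the support, and to
the right of it because the mean is zero. -/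
theorem exists_testFunction_primitive {a b : ℝ} {f : ℝ → ℝ} (hf : ContDiff ℝ (⊤ : ℕ∞) f)
    (hc : HasCompactSupport f) (hs : tsupport f ⊆ Ioo a b) (h0 : ∫ x, f x = 0) :
    ∃ ψ : 𝓓(interval a b, ℝ), deriv ψ = f := by
  rcases (tsupport f).eq_empty_or_nonempty with he | hne
  · refine ⟨0, ?_⟩
    rw [tsupport_eq_empty_iff.1 he]
    funext x
    have : ((0 : 𝓓(interval a b, ℝ)) : ℝ → ℝ) = fun _ => 0 := rfl
    rw [this]
    simp
  have hK : IsCompact (tsupport f) := hc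
  set c := sInf (tsupport f)
  set d := sSup (tsupport f)
  have hcK : c ∈ tsupport f := hK.sInf_mem hne
  have hdK : d ∈ tsupport f := hK.sSup_mem hne
  have hzl : ∀ x, x < c → f x = 0 := fun x hx =>
    image_eq_zero_of_notMem_tsupport fun h => (csInf_le hK.bddBelow h).not_gt hx
  have hzr : ∀ x, d < x → f x = 0 := fun x hx =>
    image_eq_zero_of_notMem_tsupport fun h => (le_csSup hK.bddAbove h).not_gt hx
  let ψ : ℝ → ℝ := fun x => ∫ t in c..x, f t
  have hd : ∀ x, HasDerivAt ψ (f x) x := fun x =>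
    intervalIntegral.integral_hasDerivAt_right (hf.continuous.intervalIntegrable _ _)
      (hf.continuous.stronglyMeasurableAtFilter _ _) hf.continuous.continuousAt
  have hψ0 : ∀ x, x ∉ Icc c d → ψ x = 0 := by
    intro x hx
    rcases lt_or_ge x c with h | h
    · simp only [ψ]
      rw [intervalIntegral.integral_symm, intervalIntegral.integral_of_le h.le,
        integral_Ioc_eq_integral_Ioo, setIntegral_eq_zero_of_forall_eq_zero, neg_zero]
      exact fun t ht => hzl t ht.2
    · have hxd : d < x := not_le.1 fun h' => hx ⟨h, h'⟩
      simp only [ψ]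
      rw [intervalIntegral.integral_of_le h, ← integral_Icc_eq_integral_Ioc,
        setIntegral_eq_integral_of_forall_compl_eq_zero, h0]
      intro t ht
      rcases lt_or_ge t c with h1 | h1
      · exact hzl t h1
      · exact hzr t (hxd.trans (not_le.1 fun h2 => ht ⟨h1, h2⟩))
  have hsupp : tsupport ψ ⊆ Icc c d :=
    closure_minimal (fun x hx => by by_contra h; exact hx (hψ0 x h)) isClosed_Icc
  have hdψ : deriv ψ = f := funext fun x => (hd x).deriv
  refine ⟨⟨ψ, ?_, ?_, ?_⟩, hdψ⟩
  · rw [contDiff_infty_iff_deriv, hdψ]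
    exact ⟨fun x => (hd x).differentiableAt, hf⟩
  · exact HasCompactSupport.of_support_subset_isCompact isCompact_Icc
      ((subset_tsupport ψ).trans hsupp)
  · exact hsupp.trans fun x hx => ⟨(hs hcK).1.trans_le hx.1, hx.2.trans_lt (hs hdK).2⟩

theorem ae_eq_const_of_integral_mul_deriv_eq_zero {a b : ℝ} (hab : a < b) {f : ℝ → ℝ}
    (hf : IntegrableOn f (Ioo a b))
    (h : ∀ ψ : 𝓓(interval a b, ℝ), ∫ x in Ioo a b, f x * deriv ψ x = 0) :
    ∃ C, ∀ᵐ x ∂volume.restrict (Ioo a b), f x = C := by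
  obtain ⟨χ, hχ⟩ : ∃ χ : ℝ → ℝ, ContDiff ℝ (⊤ : ℕ∞) χ ∧ HasCompactSupport χ ∧
      tsupport χ ⊆ Ioo a b ∧ ∫ x, χ x = 1 := by
    have hr : 0 < (b - a) / 4 := by linarith
    let B : ContDiffBump ((a + b) / 2) := ⟨(b - a) / 8, (b - a) / 4, by linarith, by linarith⟩
    refine ⟨B.normed volume, B.contDiff_normed, B.hasCompactSupport_normed, ?_, B.integral_normed⟩
    rw [B.tsupport_normed_eq, Real.closedBall_eq_Icc]
    intro x hx
    constructor
    · have := hx.1; simp only [B] at this; linarith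
    · have := hx.2; simp only [B] at this; linarith
  obtain ⟨hχ1, hχ2, hχ3, hχ4⟩ := hχ
  -- For a test function `η` the difference `η - (∫ η) χ` has mean zero, so it is the derivative of
  -- a test function. Testing with it gives `∫ f η = (∫ f χ)(∫ η)`, which identifies the constant.
  refine ⟨∫ x in Ioo a b, f x * χ x, ?_⟩
  set C := ∫ x in Ioo a b, f x * χ x with hC
  have hmul : ∀ η : ℝ → ℝ, Continuous η → HasCompactSupport η →
      IntegrableOn (fun x => f x * η x) (Ioo a b) := by
    intro η hη hηc
    obtain ⟨B, hB⟩ := hηc.exists_bound_of_continuous hη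
    exact Integrable.mul_bdd hf hη.aestronglyMeasurable (Eventually.of_forall hB)
  have key := isOpen_Ioo.ae_eq_zero_of_integral_contDiff_smul_eq_zero (U := Ioo a b)
    (f := (Ioo a b).indicator fun x => f x - C) (μ := volume) ?_ ?_
  · rw [ae_restrict_iff' measurableSet_Ioo]
    filter_upwards [key] with x hx hmem
    have := hx hmem
    rw [indicator_of_mem hmem] at this
    linarith
  · refine (Integrable.locallyIntegrable ?_).locallyIntegrableOn _
    rw [integrable_indicator_iff measurableSet_Ioo]
    exact hf.sub (integrable_const _)
  · intro η hη hηc hηs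
    have hηi : Integrable η := hη.continuous.integrable_of_hasCompactSupport hηc
    have hχi : Integrable χ := hχ1.continuous.integrable_of_hasCompactSupport hχ2
    obtain ⟨ψ, hψ⟩ := exists_testFunction_primitive (a := a) (b := b)
      (f := fun x => η x - (∫ y, η y) * χ x) (hη.sub (contDiff_const.mul hχ1))
      (hηc.sub (hχ2.mul_left))
      ((tsupport_sub _ _).trans (union_subset hηs ((tsupport_mul_subset_right).trans hχ3))) (by
        rw [integral_sub hηi (hχi.const_mul _), integral_const_mul, hχ4, mul_one, sub_self])
    have h1 := h ψ
    rw [hψ] at h1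
    have h2 : ∀ x, f x * (η x - (∫ y, η y) * χ x) = f x * η x - (∫ y, η y) * (f x * χ x) :=
      fun x => by ring
    simp_rw [h2] at h1
    rw [integral_sub (hmul η hη.continuous hηc)
      ((hmul χ hχ1.continuous hχ2).const_mul _), integral_const_mul, ← hC] at h1
    have h3 : ∀ x, η x • (Ioo a b).indicator (fun x => f x - C) x =
        (Ioo a b).indicator (fun x => f x * η x - C * η x) x := by
      intro x
      by_cases hx : x ∈ Ioo a b <;> simp [hx]
      ring
    simp_rw [h3]
    rw [integral_indicator measurableSet_Ioo, integral_sub (hmul η hη.continuous hηc)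
      (hηi.integrableOn.const_mul _), integral_const_mul]
    have h4 : ∫ x in Ioo a b, η x = ∫ x, η x :=
      setIntegral_eq_integral_of_forall_compl_eq_zero fun x hx =>
        image_eq_zero_of_notMem_tsupport fun h => hx (hηs h)
    rw [h4]
    linarith

/-! ### Piecewise absolutely continuous representatives -/

/-- The left-continuous function on `(a, b)` with derivative `v dx + ∑ s ∈ J, h s δ_s`. -/
def leftRep (a C : ℝ) (v : ℝ → ℝ) (J : Finset ℝ) (h : ℝ → ℝ) (x : ℝ) : ℝ :=
  C + (∫ t in a..x, v t) + ∑ s ∈ J, if s < x then h s else 0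

/-- The right-continuous function on `(a, b)` with derivative `v dx + ∑ s ∈ J, h s δ_s`. -/
def rightRep (a C : ℝ) (v : ℝ → ℝ) (J : Finset ℝ) (h : ℝ → ℝ) (x : ℝ) : ℝ :=
  C + (∫ t in a..x, v t) + ∑ s ∈ J, if s ≤ x then h s else 0

/-- `u` agrees almost everywhere on `(a, b)` with an absolutely continuous function plus finitely
many jumps. -/
def IsPiecewiseAC (a b : ℝ) (u : ℝ → ℝ) : Prop :=
  ∃ (C : ℝ) (v : ℝ → ℝ) (J : Finset ℝ) (h : ℝ → ℝ), Integrable v ∧ (J : Set ℝ) ⊆ Ioo a b ∧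
    u =ᵐ[volume.restrict (Ioo a b)] leftRep a C v J h

theorem continuous_primitive {v : ℝ → ℝ} (hv : Integrable v) (a : ℝ) :
    Continuous fun x => ∫ t in a..x, v t :=
  intervalIntegral.continuous_primitive (fun _ _ => hv.intervalIntegrable) a

theorem eventually_ite_lt_left (s x : ℝ) (c : ℝ) :
    ∀ᶠ z in 𝓝[<] x, (if s < z then c else 0) = if s < x then c else 0 := by
  by_cases h : s < x
  · filter_upwards [Ioo_mem_nhdsLT h] with z hz
    simp [h, hz.1]
  · filter_upwards [self_mem_nhdsWithin] with z hz
    have : ¬ s < z := fun h' => h (h'.trans hz)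
    simp [h, this]

theorem eventually_ite_lt_right (s x : ℝ) (c : ℝ) :
    ∀ᶠ z in 𝓝[>] x, (if s < z then c else 0) = if s ≤ x then c else 0 := by
  by_cases h : s ≤ x
  · filter_upwards [self_mem_nhdsWithin] with z hz
    have : s < z := h.trans_lt hz
    simp [h, this]
  · filter_upwards [Ioo_mem_nhdsGT (not_le.1 h)] with z hz
    simp [h, hz.2.le]

theorem tendsto_leftRep_left {v : ℝ → ℝ} (hv : Integrable v) (a C : ℝ) (J : Finset ℝ)
    (h : ℝ → ℝ) (x : ℝ) :
    Tendsto (leftRep a C v J h) (𝓝[<] x) (𝓝 (leftRep a C v J h x)) := by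
  refine (((continuous_const.add (continuous_primitive hv a)).tendsto x).mono_left
    nhdsWithin_le_nhds).add (tendsto_finsetSum _ fun s _ => ?_)
  exact tendsto_const_nhds.congr' ((eventually_ite_lt_left s x (h s)).mono fun _ h => h.symm)

theorem tendsto_leftRep_right {v : ℝ → ℝ} (hv : Integrable v) (a C : ℝ) (J : Finset ℝ)
    (h : ℝ → ℝ) (x : ℝ) :
    Tendsto (leftRep a C v J h) (𝓝[>] x) (𝓝 (rightRep a C v J h x)) := by
  refine (((continuous_const.add (continuous_primitive hv a)).tendsto x).mono_left
    nhdsWithin_le_nhds).add (tendsto_finsetSum _ fun s _ => ?_)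
  exact tendsto_const_nhds.congr' ((eventually_ite_lt_right s x (h s)).mono fun _ h => h.symm)

theorem measurable_leftRep {v : ℝ → ℝ} (hv : Integrable v) (a C : ℝ) (J : Finset ℝ)
    (h : ℝ → ℝ) : Measurable (leftRep a C v J h) :=
  (continuous_const.add (continuous_primitive hv a)).measurable.add
    (Finset.measurable_fun_sum _ fun _ _ =>
      Measurable.ite measurableSet_Ioi measurable_const measurable_const)

theorem measurable_rightRep {v : ℝ → ℝ} (hv : Integrable v) (a C : ℝ) (J : Finset ℝ)
    (h : ℝ → ℝ) : Measurable (rightRep a C v J h) :=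
  (continuous_const.add (continuous_primitive hv a)).measurable.add
    (Finset.measurable_fun_sum _ fun _ _ =>
      Measurable.ite measurableSet_Ici measurable_const measurable_const)

theorem integrableOn_leftRep {v : ℝ → ℝ} (hv : Integrable v) (a b C : ℝ) (J : Finset ℝ)
    (h : ℝ → ℝ) : IntegrableOn (leftRep a C v J h) (Ioo a b) := by
  refine Integrable.add ?_ (integrable_finsetSum _ fun s _ => ?_)
  · exact ((continuous_const.add (continuous_primitive hv a)).integrableOn_Icc).mono_set
      Ioo_subset_Icc_self
  · exact Measure.integrableOn_of_bounded (M := ‖h s‖) (by simp)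
      (Measurable.ite measurableSet_Ioi measurable_const measurable_const).aestronglyMeasurable
      (Eventually.of_forall fun x => norm_ite_le _)

theorem IsPiecewiseAC.integrableOn {a b : ℝ} {u : ℝ → ℝ} (hu : IsPiecewiseAC a b u) :
    IntegrableOn u (Ioo a b) := by
  obtain ⟨C, v, J, h, hv, -, hae⟩ := hu
  exact (integrableOn_leftRep hv a b C J h).congr hae.symm

theorem leftTrace_eq_leftRep {a b : ℝ} {u v : ℝ → ℝ} {C : ℝ} {J : Finset ℝ} {h : ℝ → ℝ}
    (hv : Integrable v) (hae : u =ᵐ[volume.restrict (Ioo a b)] leftRep a C v J h) {x : ℝ}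
    (hx : x ∈ Ioo a b) : leftTrace u x = leftRep a C v J h x := by
  have hs : Ioo a x ⊆ Ioo a b := Ioo_subset_Ioo_right hx.2.le
  exact leftTrace_eq_of_tendsto hx.1
    (IntegrableOn.mono_set ((integrableOn_leftRep hv a b C J h).congr hae.symm) hs)
    (ae_restrict_of_ae_restrict_of_subset hs hae) (tendsto_leftRep_left hv a C J h x)

theorem rightTrace_eq_rightRep {a b : ℝ} {u v : ℝ → ℝ} {C : ℝ} {J : Finset ℝ} {h : ℝ → ℝ}
    (hv : Integrable v) (hae : u =ᵐ[volume.restrict (Ioo a b)] leftRep a C v J h) {x : ℝ}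
    (hx : x ∈ Ioo a b) : rightTrace u x = rightRep a C v J h x := by
  have hs : Ioo x b ⊆ Ioo a b := Ioo_subset_Ioo_left hx.1.le
  exact rightTrace_eq_of_tendsto hx.2
    (IntegrableOn.mono_set ((integrableOn_leftRep hv a b C J h).congr hae.symm) hs)
    (ae_restrict_of_ae_restrict_of_subset hs hae) (tendsto_leftRep_right hv a C J h x)

theorem rightRep_eq_leftRep_of_notMem {a C : ℝ} {v : ℝ → ℝ} {J : Finset ℝ} {h : ℝ → ℝ} {x : ℝ}
    (hx : x ∉ J) : rightRep a C v J h x = leftRep a C v J h x := by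
  unfold rightRep leftRep
  congr 1
  refine Finset.sum_congr rfl fun s hs => ?_
  have : s ≠ x := fun h' => hx (h' ▸ hs)
  simp [le_iff_lt_or_eq, this]

/-! ### Piecewise absolutely continuous functions and `SBV` -/

theorem jumpSum_eq_sum {a b : ℝ} {k : Ioo a b → ℝ} {J : Finset ℝ} {h : ℝ → ℝ}
    (hJ : (J : Set ℝ) ⊆ Ioo a b) (hk : ∀ y : Ioo a b, k y = if (y : ℝ) ∈ J then h y else 0)
    (x : ℝ) : jumpSum k x = ∑ s ∈ J, if s < x then h s else 0 := by
  classical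
  have h1 : jumpSum k x = ∑ y ∈ J.subtype (· ∈ Ioo a b), if (y : ℝ) < x then k y else 0 := by
    refine tsum_eq_sum fun y hy => ?_
    have : (y : ℝ) ∉ J := by simpa using hy
    simp [hk, this]
  rw [h1, ← Finset.sum_subtype_of_mem (fun y => if y < x then h y else 0) (fun y hy => hJ hy)]
  refine Finset.sum_congr rfl fun y hy => ?_
  have : (y : ℝ) ∈ J := by simpa using hy
  simp [hk, this]

theorem integral_mul_deriv_of_ae_eq {a b : ℝ} (hab : a < b) {u v : ℝ → ℝ} {C : ℝ}
    {k : Ioo a b → ℝ} (hv : IntegrableOn v (Ioo a b)) (hk : Summable k)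
    (hae : ∀ᵐ x ∂volume.restrict (Ioo a b), u x = C + (∫ t in a..x, v t) + jumpSum k x)
    (ψ : 𝓓(interval a b, ℝ)) :
    ∫ x in Ioo a b, u x * deriv ψ x =
      -((∫ x in Ioo a b, v x * ψ x) + ∑' y : Ioo a b, k y * ψ y) := by
  have hvi : IntegrableOn v (Icc a b) := by rwa [integrableOn_Icc_iff_integrableOn_Ioo]
  have hV : IntegrableOn (fun x => ∫ t in a..x, v t) (Ioo a b) :=
    ((intervalIntegral.continuousOn_primitive_interval (by rwa [uIcc_of_le hab.le])).mono
      (by rw [uIcc_of_le hab.le]) |>.integrableOn_Icc).mono_set Ioo_subset_Icc_self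
  have h1 : ∫ x in Ioo a b, u x * deriv ψ x = ∫ x in Ioo a b,
      (C * deriv ψ x + (∫ t in a..x, v t) * deriv ψ x) + jumpSum k x * deriv ψ x := by
    refine integral_congr_ae ?_
    filter_upwards [hae] with x hx
    rw [hx]; ring
  rw [h1, integral_add _ (integrableOn_mul_deriv_testFunction (integrableOn_jumpSum hk) ψ),
    integral_add _ (integrableOn_mul_deriv_testFunction hV ψ), integral_const_mul,
    integral_deriv_testFunction hab, integral_primitive_mul_deriv hab hv,
    integral_jumpSum_mul_deriv hk]
  · ring
  · exact integrableOn_mul_deriv_testFunction (f := fun _ => C) (by simp) ψ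
  · exact (integrableOn_mul_deriv_testFunction (f := fun _ => C) (by simp) ψ).add
      (integrableOn_mul_deriv_testFunction hV ψ)

theorem IsPiecewiseAC.isSBV {a b : ℝ} (hab : a < b) {u : ℝ → ℝ} (hu : IsPiecewiseAC a b u) :
    IsSBV a b u := by
  refine ⟨hu.integrableOn, ?_⟩
  obtain ⟨C, v, J, h, hv, hJ, hae⟩ := hu
  classical
  let k : Ioo a b → ℝ := fun y => if (y : ℝ) ∈ J then h y else 0
  have hk : Summable k := by
    refine summable_of_ne_finset_zero (s := J.subtype (· ∈ Ioo a b)) fun y hy => ?_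
    have : (y : ℝ) ∉ J := by simpa using hy
    simp [k, this]
  refine ⟨v, k, hv.integrableOn, hk,
    integral_mul_deriv_of_ae_eq hab (C := C) hv.integrableOn hk ?_⟩
  filter_upwards [hae] with x hx
  rw [hx, jumpSum_eq_sum hJ (fun y => rfl)]
  rfl

theorem tendsto_jumpSum_left {a b : ℝ} {k : Ioo a b → ℝ} (hk : Summable k) (x : ℝ) :
    Tendsto (jumpSum k) (𝓝[<] x) (𝓝 (jumpSum k x)) :=
  tendsto_tsum_of_dominated_convergence hk.norm
    (fun y => tendsto_const_nhds.congr'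
      ((eventually_ite_lt_left (y : ℝ) x (k y)).mono fun _ h => h.symm))
    (Eventually.of_forall fun _ _ => norm_ite_le _)

theorem tendsto_jumpSum_right {a b : ℝ} {k : Ioo a b → ℝ} (hk : Summable k) (x : Ioo a b) :
    Tendsto (jumpSum k) (𝓝[>] x) (𝓝 (jumpSum k x + k x)) := by
  have h1 : jumpSum k x + k x = ∑' y : Ioo a b, if (y : ℝ) ≤ x then k y else 0 := by
    classical
    rw [← tsum_ite_eq x k, jumpSum, ← Summable.tsum_add]
    · refine tsum_congr fun y => ?_
      rcases lt_trichotomy y x with h | h | h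
      · have h' : (y : ℝ) < x := h
        simp [h', h'.le, h.ne]
      · simp [h]
      · have h' : (x : ℝ) < y := h
        simp [h'.not_gt, h'.not_ge, h.ne']
    · exact Summable.of_norm_bounded hk.norm fun y => norm_ite_le _
    · exact Summable.of_norm_bounded hk.norm fun y => norm_ite_le _
  rw [h1]
  exact tendsto_tsum_of_dominated_convergence hk.norm
    (fun y => tendsto_const_nhds.congr'
      ((eventually_ite_lt_right (y : ℝ) x (k y)).mono fun _ h => h.symm))
    (Eventually.of_forall fun _ _ => norm_ite_le _)

/-- The primitive of the density plus the pure jump function has the same distributional derivative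
as `u`, so the two differ by a constant. An atom of weight `k y` separates the traces at `y` by
exactly `k y`; hence atoms sit in the finite jump set and the series of jumps is a finite sum. -/
theorem IsSBV.exists_leftRep {a b : ℝ} (hab : a < b) {u : ℝ → ℝ} (hu : IsSBV a b u)
    (hfin : (jumpSet a b u).Finite) :
    ∃ (C : ℝ) (v : ℝ → ℝ) (J : Finset ℝ) (h : ℝ → ℝ), Integrable v ∧
      (J : Set ℝ) = jumpSet a b u ∧ u =ᵐ[volume.restrict (Ioo a b)] leftRep a C v J h := by
  obtain ⟨hui, v₀, k, hv₀, hk, hweak⟩ := hu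
  -- Extension by zero makes the density integrable on the whole line, so that primitives need no
  -- restriction on their endpoints.
  set v := (Ioo a b).indicator v₀
  have hv : Integrable v := (integrable_indicator_iff measurableSet_Ioo).2 hv₀
  have hvv : ∀ ψ : 𝓓(interval a b, ℝ), ∫ x in Ioo a b, v x * ψ x = ∫ x in Ioo a b, v₀ x * ψ x :=
    fun ψ => setIntegral_congr_fun measurableSet_Ioo fun x hx => by simp [v, hx]
  have hVc := continuous_primitive hv a
  have hrep : IntegrableOn (fun x => (∫ t in a..x, v t) + jumpSum k x) (Ioo a b) :=
    (hVc.integrableOn_Icc.mono_set Ioo_subset_Icc_self).add (integrableOn_jumpSum hk)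
  obtain ⟨C, hC⟩ := ae_eq_const_of_integral_mul_deriv_eq_zero hab (hui.sub hrep) (by
    intro ψ
    have h1 := integral_mul_deriv_of_ae_eq hab (C := 0) hv.integrableOn hk
      (u := fun x => (∫ t in a..x, v t) + jumpSum k x)
      (Eventually.of_forall fun x => by ring) ψ
    have h2 : ∀ x, (u - fun x => (∫ t in a..x, v t) + jumpSum k x) x * deriv ψ x =
        u x * deriv ψ x - ((∫ t in a..x, v t) + jumpSum k x) * deriv ψ x := fun x => by
      simp only [Pi.sub_apply]; ring
    simp_rw [h2]
    rw [integral_sub (integrableOn_mul_deriv_testFunction hui ψ)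
      (integrableOn_mul_deriv_testFunction hrep ψ), h1, hweak, hvv, sub_self])
  have hae : ∀ᵐ x ∂volume.restrict (Ioo a b), u x = C + (∫ t in a..x, v t) + jumpSum k x := by
    filter_upwards [hC] with x hx
    simp only [Pi.sub_apply] at hx
    linarith
  have hjump : ∀ y : Ioo a b, k y ≠ 0 → (y : ℝ) ∈ jumpSet a b u := by
    intro y hy
    refine ⟨y.2, ?_⟩
    have hCV := (continuous_const (y := C)).add hVc
    have hsl : Ioo a (y : ℝ) ⊆ Ioo a b := Ioo_subset_Ioo_right y.2.2.le
    have hsr : Ioo (y : ℝ) b ⊆ Ioo a b := Ioo_subset_Ioo_left y.2.1.le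
    rw [leftTrace_eq_of_tendsto y.2.1 (hui.mono_set hsl)
        (ae_restrict_of_ae_restrict_of_subset hsl hae)
        (((hCV.tendsto y).mono_left nhdsWithin_le_nhds).add (tendsto_jumpSum_left hk y)),
      rightTrace_eq_of_tendsto y.2.2 (hui.mono_set hsr)
        (ae_restrict_of_ae_restrict_of_subset hsr hae)
        (((hCV.tendsto y).mono_left nhdsWithin_le_nhds).add (tendsto_jumpSum_right hk y))]
    intro h
    exact hy (by linarith)
  classical
  refine ⟨C, v, hfin.toFinset, fun s => if hs : s ∈ Ioo a b then k ⟨s, hs⟩ else 0, hv,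
    hfin.coe_toFinset, ?_⟩
  · filter_upwards [hae] with x hx
    rw [hx, leftRep, jumpSum_eq_sum (J := hfin.toFinset)
      (h := fun s => if hs : s ∈ Ioo a b then k ⟨s, hs⟩ else 0)]
    · intro s hs
      exact ((hfin.mem_toFinset).1 (Finset.mem_coe.1 hs)).1
    · intro y
      by_cases hy : (y : ℝ) ∈ jumpSet a b u
      · rw [if_pos (hfin.mem_toFinset.2 hy), dif_pos y.2]
      · rw [if_neg (fun h => hy (hfin.mem_toFinset.1 h))]
        by_contra h
        exact hy (hjump y h)

theorem IsSBV.isPiecewiseAC {a b : ℝ} (hab : a < b) {u : ℝ → ℝ} (hu : IsSBV a b u)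
    (hfin : (jumpSet a b u).Finite) : IsPiecewiseAC a b u := by
  obtain ⟨C, v, J, h, hv, hJ, hae⟩ := hu.exists_leftRep hab hfin
  exact ⟨C, v, J, h, hv, hJ ▸ fun x hx => hx.1, hae⟩

/-! ### Pasting -/

theorem IsPiecewiseAC.add {a b : ℝ} {u w : ℝ → ℝ} (hu : IsPiecewiseAC a b u)
    (hw : IsPiecewiseAC a b w) : IsPiecewiseAC a b fun x => u x + w x := by
  classical
  obtain ⟨C, v, J, h, hv, hJ, hae⟩ := hu
  obtain ⟨C', v', J', h', hv', hJ', hae'⟩ := hw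
  refine ⟨C + C', fun x => v x + v' x, J ∪ J',
    fun s => (if s ∈ J then h s else 0) + if s ∈ J' then h' s else 0, hv.add hv',
    by simp [hJ, hJ'], ?_⟩
  filter_upwards [hae, hae'] with x hx hx'
  rw [hx, hx', leftRep, leftRep, leftRep,
    intervalIntegral.integral_add hv.intervalIntegrable hv'.intervalIntegrable]
  have h1 : ∑ s ∈ J, (if s < x then h s else 0) =
      ∑ s ∈ J ∪ J', if s < x then (if s ∈ J then h s else 0) else 0 := by
    rw [← Finset.sum_subset Finset.subset_union_left (fun s _ hs => by simp [hs])]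
    exact Finset.sum_congr rfl fun s hs => by simp [hs]
  have h2 : ∑ s ∈ J', (if s < x then h' s else 0) =
      ∑ s ∈ J ∪ J', if s < x then (if s ∈ J' then h' s else 0) else 0 := by
    rw [← Finset.sum_subset Finset.subset_union_right (fun s _ hs => by simp [hs])]
    exact Finset.sum_congr rfl fun s hs => by simp [hs]
  have h3 : ∀ s, (if s < x then ((if s ∈ J then h s else 0) + if s ∈ J' then h' s else 0) else 0) =
      (if s < x then (if s ∈ J then h s else 0) else 0) +
      (if s < x then (if s ∈ J' then h' s else 0) else 0) := fun s => by split_ifs <;> simp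
  simp_rw [h3]
  rw [h1, h2, Finset.sum_add_distrib]
  ring

theorem IsPiecewiseAC.neg {a b : ℝ} {u : ℝ → ℝ} (hu : IsPiecewiseAC a b u) :
    IsPiecewiseAC a b fun x => -u x := by
  obtain ⟨C, v, J, h, hv, hJ, hae⟩ := hu
  refine ⟨-C, fun x => -v x, J, fun s => -h s, hv.neg, hJ, ?_⟩
  filter_upwards [hae] with x hx
  have h3 : ∀ s, (if s < x then -h s else 0) = -(if s < x then h s else 0) := fun s => by
    split_ifs <;> simp
  rw [hx, leftRep, leftRep, intervalIntegral.integral_neg]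
  simp_rw [h3]
  rw [Finset.sum_neg_distrib]
  ring

theorem IsPiecewiseAC.ite_lt {a b : ℝ} {u : ℝ → ℝ} (hu : IsPiecewiseAC a b u) {y : ℝ}
    (hy : y ∈ Ioo a b) : IsPiecewiseAC a b fun x => if y < x then u x else 0 := by
  classical
  obtain ⟨C, v, J, h, hv, hJ, hae⟩ := hu
  -- The cut function jumps at `y` from `0` to the right limit of `u`; the jumps before `y`
  -- disappear and those after it are kept.
  refine ⟨0, (Ioi y).indicator v, insert y J,
    fun s => if s = y then rightRep a C v J h y else if y < s then h s else 0,
    hv.indicator measurableSet_Ioi, ?_, ?_⟩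
  · intro s hs
    rcases Finset.mem_insert.1 (Finset.mem_coe.1 hs) with rfl | hs
    · exact hy
    · exact hJ hs
  · filter_upwards [hae, ae_restrict_mem measurableSet_Ioo] with x hx hmem
    rw [hx, ← Finset.insert_erase (Finset.mem_insert_self y J)]
    conv_rhs => rw [leftRep]
    rw [Finset.sum_insert (Finset.notMem_erase y _), Finset.erase_insert_eq_erase]
    have hsum : ∑ s ∈ J.erase y, (if s < x then (if s = y then rightRep a C v J h y else
        if y < s then h s else 0) else 0) =
        ∑ s ∈ J, if s < x then (if y < s then h s else 0) else 0 := by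
      rw [← Finset.sum_subset (Finset.erase_subset y J) (fun s hs hs' => ?_)]
      · refine Finset.sum_congr rfl fun s hs => ?_
        rw [if_neg (Finset.ne_of_mem_erase hs)]
      · have : s = y := by
          by_contra hne
          exact hs' (Finset.mem_erase.2 ⟨hne, hs⟩)
        simp [this]
    rw [hsum]
    by_cases hyx : y < x
    · have hint : ∫ t in a..x, (Ioi y).indicator v t = ∫ t in y..x, v t := by
        rw [intervalIntegral.integral_of_le hmem.1.le, intervalIntegral.integral_of_le hyx.le,
          setIntegral_indicator measurableSet_Ioi]
        congr 2
        ext t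
        simp only [mem_inter_iff, mem_Ioc, mem_Ioi]
        exact ⟨fun h => ⟨h.2, h.1.2⟩, fun h => ⟨⟨hy.1.trans h.1, h.2⟩, h.1⟩⟩
      have hadd : (∫ t in a..y, v t) + ∫ t in y..x, v t = ∫ t in a..x, v t :=
        intervalIntegral.integral_add_adjacent_intervals hv.intervalIntegrable hv.intervalIntegrable
      have hs : (∑ s ∈ J, if s < x then h s else 0) = (∑ s ∈ J, if s ≤ y then h s else 0) +
          ∑ s ∈ J, if s < x then (if y < s then h s else 0) else 0 := by
        rw [← Finset.sum_add_distrib]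
        refine Finset.sum_congr rfl fun s _ => ?_
        by_cases h1 : s ≤ y
        · simp [h1, h1.trans_lt hyx, h1.not_gt]
        · simp [h1, not_le.1 h1]
      simp only [if_pos hyx, if_true, hint, leftRep, rightRep]
      rw [hs, ← hadd]
      ring
    · have hint : ∫ t in a..x, (Ioi y).indicator v t = 0 := by
        rw [intervalIntegral.integral_of_le hmem.1.le]
        refine setIntegral_eq_zero_of_forall_eq_zero fun t ht => ?_
        exact indicator_of_notMem (fun h => hyx (lt_of_lt_of_le h ht.2)) _
      have hs : (∑ s ∈ J, if s < x then (if y < s then h s else 0) else 0) = 0 := by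
        refine Finset.sum_eq_zero fun s _ => ?_
        by_cases h1 : s < x
        · simp [h1, h1.le.trans (not_lt.1 hyx)]
        · simp [h1]
      simp [hyx, hint, hs]

/-- Induction on the largest point `m`: adding `m` to the set changes the pasted function only
beyond `m`, by the cut-off difference of two consecutive pieces. -/
theorem IsPiecewiseAC.paste {a b : ℝ} (S : Finset ℝ) (hS : (S : Set ℝ) ⊆ Ioo a b)
    {U : ℕ → ℝ → ℝ} (hU : ∀ n, IsPiecewiseAC a b (U n)) :
    IsPiecewiseAC a b fun x => U (S.filter (· < x)).card x := by
  classical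
  induction S using Finset.induction_on_max with
  | empty => simpa using hU 0
  | insert m S hm ih =>
    have hm' : m ∉ S := fun h => lt_irrefl _ (hm m h)
    have h1 : (S : Set ℝ) ⊆ Ioo a b := fun s hs => hS (by simp [Finset.mem_coe.1 hs])
    have h2 : m ∈ Ioo a b := hS (by simp)
    have key : (fun x => U ((insert m S).filter (· < x)).card x) = fun x =>
        U (S.filter (· < x)).card x +
          if m < x then (U (S.card + 1) x + -U S.card x) else 0 := by
      funext x
      by_cases hx : m < x
      · have h3 : S.filter (· < x) = S := Finset.filter_true_of_mem fun s hs => (hm s hs).trans hx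
        rw [Finset.filter_insert, if_pos hx, if_pos hx, h3, Finset.card_insert_of_notMem hm']
        ring
      · rw [Finset.filter_insert, if_neg hx, if_neg hx, add_zero]
    rw [key]
    exact (ih h1).add (((hU _).add (hU _).neg).ite_lt h2)

/-! ### Derivatives on level sets and on preimages of null sets -/

/-- A set of reals has only countably many points that are isolated in it from the right. Together
with the next lemma this yields derivatives on level sets. -/
theorem ae_mem_imp_neBot_right (E : Set ℝ) : ∀ᵐ s : ℝ, s ∈ E → (𝓝[E ∩ Ioi s] s).NeBot := by
  have h := (countable_setOfPred_isolated_right_within (s := E)).ae_notMem volume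
  filter_upwards [h] with s hs hmem
  exact ⟨fun h' => hs ⟨hmem, h'⟩⟩

theorem deriv_eq_zero_of_eq_zero_on {f : ℝ → ℝ} {f' s : ℝ} {E : Set ℝ} (hf : HasDerivAt f f' s)
    (hs : s ∈ E) (hE : ∀ t ∈ E, f t = 0) (hacc : (𝓝[E ∩ Ioi s] s).NeBot) : f' = 0 := by
  have h1 := (hasDerivAt_iff_tendsto_slope.1 hf).mono_left
    (nhdsWithin_mono s (fun t (ht : t ∈ E ∩ Ioi s) => (ne_of_gt ht.2 : t ≠ s)))
  refine tendsto_nhds_unique h1 (tendsto_const_nhds.congr' ?_)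
  filter_upwards [self_mem_nhdsWithin] with t ht
  simp [slope, hE t ht.1, hE s hs]

theorem exists_antilipschitz_of_deriv_ne_zero {γ : ℝ → Plane} {s : ℝ} (h : deriv γ s ≠ 0) :
    ∃ n : ℕ, ∀ t, |t - s| < 1 / ((n : ℝ) + 1) → |t - s| ≤ ((n : ℝ) + 1) * dist (γ t) (γ s) := by
  have hd : HasDerivAt γ (deriv γ s) s :=
    (not_imp_comm.1 deriv_zero_of_not_differentiableAt h).hasDerivAt
  have hpos : 0 < ‖deriv γ s‖ := norm_pos_iff.2 h
  have h1 := ((hasDerivAt_iff_tendsto_slope.1 hd).norm).eventually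
    (lt_mem_nhds (half_lt_self hpos))
  rw [eventually_nhdsWithin_iff, Metric.eventually_nhds_iff] at h1
  obtain ⟨ε, hε, h1⟩ := h1
  obtain ⟨n, hn⟩ := exists_nat_one_div_lt (lt_min hε (half_pos hpos))
  refine ⟨n, fun t ht => ?_⟩
  rcases eq_or_ne t s with rfl | hts
  · simp
  have h2 := h1 (y := t) (by rw [Real.dist_eq]; exact ht.trans (hn.trans_le (min_le_left _ _))) hts
  rw [slope_def_module, norm_smul, norm_inv, Real.norm_eq_abs, ← dist_eq_norm] at h2
  have h3 : 0 < |t - s| := abs_pos.2 (sub_ne_zero.2 hts)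
  have h4 : 1 / ((n : ℝ) + 1) < |t - s|⁻¹ * dist (γ t) (γ s) :=
    (hn.trans_le (min_le_right _ _)).trans h2
  rw [inv_mul_eq_div, div_lt_div_iff₀ (by positivity) h3] at h4
  linarith

/-- Where `γ' ≠ 0` the curve expands distances from below, at some scale `1/(n+1)` with constant
`n+1`. Grouping such times by `n` and by intervals of that length, `γ` has a Lipschitz inverse on
each piece. Each piece is then a Lipschitz image of a part of `Z`, hence null. -/
theorem ae_deriv_eq_zero_of_hausdorff_null (γ : ℝ → Plane) {Z : Set Plane} (hZ : μH[1] Z = 0) :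
    ∀ᵐ s : ℝ, γ s ∈ Z → deriv γ s = 0 := by
  let B : ℕ → ℤ → Set ℝ := fun n m => {s | γ s ∈ Z ∧
    (∀ t, |t - s| < 1 / ((n : ℝ) + 1) → |t - s| ≤ ((n : ℝ) + 1) * dist (γ t) (γ s)) ∧
    ⌊s * ((n : ℝ) + 1)⌋ = m}
  have hsub : {s | ¬ (γ s ∈ Z → deriv γ s = 0)} ⊆ ⋃ n, ⋃ m, B n m := by
    intro s hs
    simp only [mem_ofPred_eq, Classical.not_imp] at hs
    obtain ⟨n, hn⟩ := exists_antilipschitz_of_deriv_ne_zero hs.2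
    exact mem_iUnion₂.2 ⟨n, ⌊s * ((n : ℝ) + 1)⌋, hs.1, hn, rfl⟩
  refine measure_mono_null hsub (measure_iUnion_null fun n => measure_iUnion_null fun m => ?_)
  have hdist : ∀ s ∈ B n m, ∀ t ∈ B n m, dist s t ≤ ((n : ℝ) + 1) * dist (γ s) (γ t) := by
    intro s hs t ht
    have h1 := Int.abs_sub_lt_one_of_floor_eq_floor (hs.2.2.trans ht.2.2.symm)
    rw [← sub_mul, abs_mul, abs_of_pos (by positivity : (0 : ℝ) < n + 1)] at h1
    exact ht.2.1 s (by rwa [lt_div_iff₀ (by positivity)])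
  have hinj : InjOn γ (B n m) := by
    intro s hs t ht hst
    have := hdist s hs t ht
    rw [hst, dist_self, mul_zero] at this
    exact dist_le_zero.1 this
  have hlip : LipschitzOnWith ((n : ℝ≥0) + 1) (Function.invFunOn γ (B n m)) (γ '' B n m) := by
    refine LipschitzOnWith.of_dist_le_mul ?_
    rintro _ ⟨s, hs, rfl⟩ _ ⟨t, ht, rfl⟩
    rw [hinj.leftInvOn_invFunOn hs, hinj.leftInvOn_invFunOn ht]
    simpa using hdist s hs t ht
  have h1 := hlip.hausdorffMeasure_image_le (d := 1) zero_le_one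
  rw [hinj.leftInvOn_invFunOn.image_image, hausdorffMeasure_real,
    measure_mono_null (image_subset_iff.2 fun s hs => hs.1) hZ, mul_zero] at h1
  exact le_antisymm h1 bot_le

/-! ### Graphs of absolutely continuous functions -/

theorem dist_plane_le (x y t s : ℝ) : dist !₂[x, t] !₂[y, s] ≤ |x - y| + |t - s| := by
  rw [EuclideanSpace.dist_eq, Fin.sum_univ_two]
  refine Real.sqrt_le_iff.2 ⟨by positivity, ?_⟩
  simp only [Real.dist_eq, Matrix.cons_val_zero, Matrix.cons_val_one]
  nlinarith [abs_nonneg (x - y), abs_nonneg (t - s)]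

theorem plane_eta (p : Plane) : !₂[p 0, p 1] = p := by
  ext i; fin_cases i <;> rfl

/-- The parameter `x + ∫ₐˣ |v|`, in which graphs of primitives of `v` are Lipschitz curves. -/
def graphParam (a : ℝ) (v : ℝ → ℝ) (x : ℝ) : ℝ := x + ∫ t in a..x, |v t|

theorem graphParam_sub {v : ℝ → ℝ} (hv : Integrable v) (a x y : ℝ) :
    graphParam a v y - graphParam a v x = (y - x) + ∫ t in x..y, |v t| := by
  have : (∫ t in a..x, |v t|) + ∫ t in x..y, |v t| = ∫ t in a..y, |v t| :=
    intervalIntegral.integral_add_adjacent_intervals hv.abs.intervalIntegrable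
      hv.abs.intervalIntegrable
  unfold graphParam
  linarith

theorem strictMono_graphParam {v : ℝ → ℝ} (hv : Integrable v) (a : ℝ) :
    StrictMono (graphParam a v) := by
  intro x y hxy
  have h1 := graphParam_sub hv a x y
  have h2 : 0 ≤ ∫ t in x..y, |v t| :=
    intervalIntegral.integral_nonneg hxy.le fun t _ => abs_nonneg _
  linarith

theorem continuous_graphParam {v : ℝ → ℝ} (hv : Integrable v) (a : ℝ) :
    Continuous (graphParam a v) :=
  continuous_id.add (continuous_primitive hv.abs a)

/-- Pulling Lebesgue measure back along the parameter gives `(1 + |v|) dx`, as one checks on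
half-open intervals, and this measure is absolutely continuous. -/
theorem volume_graphParam_image_null {v : ℝ → ℝ} (hv : Integrable v) (a : ℝ) {N : Set ℝ}
    (hN : volume N = 0) : volume (graphParam a v '' N) = 0 := by
  have hemb : MeasurableEmbedding (graphParam a v) :=
    (continuous_graphParam hv a).measurableEmbedding (strictMono_graphParam hv a).injective
  have heq : volume + volume.withDensity (fun t => ENNReal.ofReal |v t|) =
      volume.comap (graphParam a v) := by
    refine Measure.ext_of_Ioc' _ _ (fun x y hxy => ?_) (fun x y hxy => ?_)
    · have h1 : ∫⁻ t in Ioc x y, ENNReal.ofReal |v t| ≠ ∞ := by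
        rw [← ofReal_integral_eq_lintegral_ofReal hv.abs.integrableOn
          (Eventually.of_forall fun t => abs_nonneg _)]
        exact ENNReal.ofReal_ne_top
      simp [withDensity_apply _ measurableSet_Ioc, h1]
    · have himg : graphParam a v '' Ioc x y = Ioc (graphParam a v x) (graphParam a v y) := by
        refine Subset.antisymm ?_ ?_
        · rintro _ ⟨z, hz, rfl⟩
          exact ⟨strictMono_graphParam hv a hz.1, (strictMono_graphParam hv a).monotone hz.2⟩
        · exact intermediate_value_Ioc hxy.le (continuous_graphParam hv a).continuousOn
      rw [hemb.comap_apply, himg, Real.volume_Ioc, graphParam_sub hv, add_apply,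
        withDensity_apply _ measurableSet_Ioc, Real.volume_Ioc,
        ← ofReal_integral_eq_lintegral_ofReal hv.abs.integrableOn
          (Eventually.of_forall fun t => abs_nonneg _), intervalIntegral.integral_of_le hxy.le,
        ENNReal.ofReal_add (sub_nonneg.2 hxy.le) (integral_nonneg fun t => abs_nonneg _)]
  rw [← hemb.comap_apply, ← heq, add_apply, hN, zero_add]
  exact withDensity_absolutelyContinuous _ _ hN

/-- The graph map of the primitive of `v` with value `C` at `a`. -/
def graphMap (a C : ℝ) (v : ℝ → ℝ) (x : ℝ) : Plane := !₂[x, C + ∫ t in a..x, v t]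

/-- The increment of the parameter is `|Δx| + ∫ |v|`, which dominates the sum of the horizontal and
vertical increments along the graph. -/
theorem exists_lipschitz_graphMap {v : ℝ → ℝ} (hv : Integrable v) (a C : ℝ) (N : Set ℝ) :
    ∃ f : ℝ → Plane, LipschitzOnWith 1 f (graphParam a v '' N) ∧
      f '' (graphParam a v '' N) = graphMap a C v '' N := by
  have hli : Function.LeftInverse (Function.invFun (graphParam a v)) (graphParam a v) :=
    Function.leftInverse_invFun (strictMono_graphParam hv a).injective
  refine ⟨fun s => graphMap a C v (Function.invFun (graphParam a v) s),
    LipschitzOnWith.of_dist_le_mul ?_, ?_⟩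
  · rintro _ ⟨x, -, rfl⟩ _ ⟨y, -, rfl⟩
    simp only [hli x, hli y, NNReal.coe_one, one_mul]
    refine (dist_plane_le _ _ _ _).trans ?_
    wlog hxy : y ≤ x generalizing x y
    · rw [abs_sub_comm x, abs_sub_comm (C + _), dist_comm]
      exact this y x (le_of_not_ge hxy)
    have h2 : (∫ t in a..x, v t) - ∫ t in a..y, v t = ∫ t in y..x, v t :=
      intervalIntegral.integral_interval_sub_left hv.intervalIntegrable hv.intervalIntegrable
    rw [add_sub_add_left_eq_sub, h2, Real.dist_eq, graphParam_sub hv]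
    have h3 := intervalIntegral.abs_integral_le_integral_abs (f := v) (μ := volume) hxy
    refine le_trans ?_ (le_abs_self _)
    rw [abs_of_nonneg (sub_nonneg.2 hxy)]
    linarith
  · rw [image_image]
    exact image_congr fun x _ => by rw [hli x]

theorem hausdorff_graphMap_le {v : ℝ → ℝ} (hv : Integrable v) (a C : ℝ) (N : Set ℝ) :
    μH[1] (graphMap a C v '' N) ≤ volume (graphParam a v '' N) := by
  obtain ⟨f, hf, himg⟩ := exists_lipschitz_graphMap hv a C N
  rw [← himg, ← hausdorffMeasure_real]
  simpa using hf.hausdorffMeasure_image_le (d := 1) zero_le_one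

theorem hausdorff_graphMap_Ioo_lt_top {v : ℝ → ℝ} (hv : Integrable v) (a C c d : ℝ) :
    μH[1] (graphMap a C v '' Ioo c d) < ∞ := by
  refine (hausdorff_graphMap_le hv a C _).trans_lt ((measure_mono
    (t := Icc (graphParam a v c) (graphParam a v d)) ?_).trans_lt (by simp))
  rintro _ ⟨x, hx, rfl⟩
  exact ⟨(strictMono_graphParam hv a).monotone hx.1.le,
    (strictMono_graphParam hv a).monotone hx.2.le⟩

/-! ### Vertical lines -/

theorem isometry_vertical (y : ℝ) : Isometry fun t : ℝ => (!₂[y, t] : Plane) := by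
  refine Isometry.of_dist_eq fun t s => ?_
  rw [EuclideanSpace.dist_eq, Fin.sum_univ_two]
  simp [Real.dist_eq, Real.sqrt_sq_eq_abs]

theorem range_vertical (y : ℝ) : range (fun t : ℝ => (!₂[y, t] : Plane)) = {p | p 0 = y} := by
  ext p
  constructor
  · rintro ⟨t, rfl⟩; rfl
  · intro h; exact ⟨p 1, by rw [← (h : p 0 = y)]; exact plane_eta p⟩

theorem map_vertical (y : ℝ) : volume.map (fun t : ℝ => (!₂[y, t] : Plane)) =
    (μH[1] : Measure Plane).restrict {p | p 0 = y} := by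
  rw [← hausdorffMeasure_real, (isometry_vertical y).map_hausdorffMeasure (Or.inl zero_le_one),
    range_vertical]

theorem measurableEmbedding_vertical (y : ℝ) :
    MeasurableEmbedding fun t : ℝ => (!₂[y, t] : Plane) :=
  (isometry_vertical y).isClosedEmbedding.measurableEmbedding

/-! ### Countably rectifiable sets -/

theorem IsCountablyRectifiable.of_countable {ι : Type*} [Countable ι] {M : Set Plane}
    (f : ι → ℝ → Plane) (s : ι → Set ℝ) (C : ι → ℝ≥0)
    (hf : ∀ i, LipschitzOnWith (C i) (f i) (s i)) (hM : M ⊆ ⋃ i, f i '' s i) :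
    IsCountablyRectifiable M := by
  rcases isEmpty_or_nonempty ι with he | hne
  · have hM' : M = ∅ := by simpa using hM
    exact ⟨fun _ _ => 0, fun _ => ∅, fun _ => 0, fun n => by simp, by simp [hM']⟩
  · obtain ⟨e, he⟩ := exists_surjective_nat ι
    refine ⟨fun n => f (e n), fun n => s (e n), fun n => C (e n), fun n => hf _, ?_⟩
    have : M \ ⋃ n, f (e n) '' s (e n) = ∅ := by
      rw [sdiff_eq_empty, he.iUnion_comp fun i => f i '' s i]
      exact hM
    rw [this, measure_empty]

theorem IsCountablyRectifiable.iUnion {ι : Type*} [Countable ι] {M : ι → Set Plane}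
    (h : ∀ i, IsCountablyRectifiable (M i)) : IsCountablyRectifiable (⋃ i, M i) := by
  choose f s C hf hM using h
  rcases isEmpty_or_nonempty ι with he | hne
  · exact IsCountablyRectifiable.of_countable (ι := ι) (fun _ _ => 0) (fun _ => ∅) (fun _ => 0)
      (fun i => by simp) (by simp)
  · obtain ⟨e, he⟩ := exists_surjective_nat (ι × ℕ)
    refine ⟨fun n => f (e n).1 (e n).2, fun n => s (e n).1 (e n).2, fun n => C (e n).1 (e n).2,
      fun n => hf _ _, ?_⟩
    rw [he.iUnion_comp fun q : ι × ℕ => f q.1 q.2 '' s q.1 q.2, iUnion_prod', iUnion_sdiff]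
    refine measure_iUnion_null fun i => measure_mono_null ?_ (hM i)
    exact sdiff_subset_sdiff_right (subset_iUnion (fun i => ⋃ n, f i n '' s i n) i)

theorem IsCountablyRectifiable.mono {M M' : Set Plane} (h : IsCountablyRectifiable M')
    (hM : M ⊆ M') : IsCountablyRectifiable M := by
  obtain ⟨f, s, C, hf, h0⟩ := h
  exact ⟨f, s, C, hf, measure_mono_null (sdiff_subset_sdiff_left hM) h0⟩

theorem IsCountablyRectifiable.union {M M' : Set Plane} (h : IsCountablyRectifiable M)
    (h' : IsCountablyRectifiable M') : IsCountablyRectifiable (M ∪ M') := by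
  rw [union_eq_iUnion]
  exact IsCountablyRectifiable.iUnion fun b => by cases b <;> assumption

/-! ### Extended graphs of `SBV` functions with finitely many jumps -/

theorem extGraph_subset_strip (a b : ℝ) (u : ℝ → ℝ) : extGraph a b u ⊆ strip a b :=
  fun _ hp => hp.1

theorem eq_leftTrace_of_mem_extGraph {a b : ℝ} {u : ℝ → ℝ} {p : Plane} (hp : p ∈ extGraph a b u)
    (hJ : p 0 ∉ jumpSet a b u) : p 1 = leftTrace u (p 0) := by
  have h : leftTrace u (p 0) = rightTrace u (p 0) := by
    by_contra h
    exact hJ ⟨hp.1, h⟩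
  have h2 := hp.2
  rw [← h, min_self, max_self] at h2
  exact le_antisymm h2.2 h2.1

theorem leftTrace_eq_rightTrace_of_notMem {a b : ℝ} {u : ℝ → ℝ} {x : ℝ} (hx : x ∈ Ioo a b)
    (hJ : x ∉ jumpSet a b u) : leftTrace u x = rightTrace u x := by
  by_contra h
  exact hJ ⟨hx, h⟩

theorem preciseRep_eq_leftTrace {a b : ℝ} {u : ℝ → ℝ} {x : ℝ} (hx : x ∈ Ioo a b)
    (hJ : x ∉ jumpSet a b u) : preciseRep u x = leftTrace u x := by
  rw [preciseRep, ← leftTrace_eq_rightTrace_of_notMem hx hJ]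
  ring

theorem norm_graphOrientation (u : ℝ → ℝ) (p : Plane) : ‖graphOrientation u p‖ = 1 := by
  unfold graphOrientation
  split_ifs with h
  · have hpos : 0 < 1 + apDeriv u (p 0) ^ 2 := by positivity
    rw [norm_smul, EuclideanSpace.norm_eq, Fin.sum_univ_two]
    simp only [Real.norm_eq_abs, sq_abs, Matrix.cons_val_zero, Matrix.cons_val_one, one_pow]
    rw [abs_of_pos (inv_pos.2 (Real.sqrt_pos.2 hpos))]
    exact inv_mul_cancel₀ (Real.sqrt_pos.2 hpos).ne'
  · have h' : rightTrace u (p 0) - leftTrace u (p 0) ≠ 0 := sub_ne_zero.2 (Ne.symm h)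
    rw [EuclideanSpace.norm_eq, Fin.sum_univ_two]
    rcases lt_or_gt_of_ne h' with h1 | h1
    · simp [sign_neg h1]
    · simp [sign_pos h1]

section Graph

variable {a b : ℝ} {u : ℝ → ℝ}

theorem measurableSet_extGraph (hab : a < b) (hu : IsSBV a b u)
    (hfin : (jumpSet a b u).Finite) : MeasurableSet (extGraph a b u) := by
  obtain ⟨C, v, J, h, hv, hJ, hae⟩ := hu.exists_leftRep hab hfin
  have hL := measurable_leftRep hv a C J h
  have hR := measurable_rightRep hv a C J h
  have h0 : Measurable fun p : Plane => p 0 := by fun_prop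
  have h1 : Measurable fun p : Plane => p 1 := by fun_prop
  have : extGraph a b u = {p : Plane | p 0 ∈ Ioo a b} ∩
      ({p | min (leftRep a C v J h (p 0)) (rightRep a C v J h (p 0)) ≤ p 1} ∩
       {p | p 1 ≤ max (leftRep a C v J h (p 0)) (rightRep a C v J h (p 0))}) := by
    ext p
    simp only [extGraph, mem_ofPred_eq, mem_inter_iff]
    refine and_congr_right fun hp => ?_
    rw [leftTrace_eq_leftRep hv hae hp, rightTrace_eq_rightRep hv hae hp]
  rw [this]
  exact (h0 measurableSet_Ioo).inter
    ((measurableSet_le ((hL.comp h0).min (hR.comp h0)) h1).inter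
      (measurableSet_le h1 ((hL.comp h0).max (hR.comp h0))))

theorem measurable_apDeriv (u : ℝ → ℝ) : Measurable (apDeriv u) := measurable_deriv _

theorem measurable_plane {X : Type*} [MeasurableSpace X] {f g : X → ℝ} (hf : Measurable f)
    (hg : Measurable g) : Measurable fun x => (!₂[f x, g x] : Plane) := by
  refine (WithLp.measurable_toLp 2 _).comp (measurable_pi_iff.2 fun i => ?_)
  fin_cases i
  · exact hf
  · exact hg

/-- The orientation of the extended graph, extended by zero. -/
def graphField (a b : ℝ) (u : ℝ → ℝ) : Plane → Plane :=
  (extGraph a b u).indicator (graphOrientation u)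

theorem measurable_graphField (hab : a < b) (hu : IsSBV a b u)
    (hfin : (jumpSet a b u).Finite) : Measurable (graphField a b u) := by
  obtain ⟨C, v, J, h, hv, hJ, hae⟩ := hu.exists_leftRep hab hfin
  have h0 : Measurable fun p : Plane => p 0 := by fun_prop
  have hL := (measurable_leftRep hv a C J h).comp h0
  have hR := (measurable_rightRep hv a C J h).comp h0
  have hd := (measurable_apDeriv u).comp h0
  have heq : graphField a b u = (extGraph a b u).indicator fun p =>
      if leftRep a C v J h (p 0) = rightRep a C v J h (p 0) then
        (√(1 + apDeriv u (p 0) ^ 2))⁻¹ • (!₂[1, apDeriv u (p 0)] : Plane)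
      else !₂[0, if 0 < rightRep a C v J h (p 0) - leftRep a C v J h (p 0) then 1 else -1] := by
    refine indicator_congr fun p hp => ?_
    unfold graphOrientation
    rw [leftTrace_eq_leftRep hv hae hp.1, rightTrace_eq_rightRep hv hae hp.1]
    refine ite_congr rfl (fun _ => rfl) fun h' => ?_
    rcases lt_or_gt_of_ne (sub_ne_zero.2 (Ne.symm h')) with h1 | h1
    · rw [sign_neg h1, if_neg h1.not_gt]; simp
    · rw [sign_pos h1, if_pos h1]; simp
  rw [heq]
  refine Measurable.indicator (Measurable.ite (measurableSet_eq_fun hL hR) ?_ ?_)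
    (measurableSet_extGraph hab hu hfin)
  · exact ((measurable_const.add (hd.pow_const 2)).sqrt.inv).smul
      (measurable_plane measurable_const hd)
  · exact measurable_plane measurable_const (Measurable.ite
      (measurableSet_lt measurable_const (hR.sub hL)) measurable_const measurable_const)

/-- Off the jump set the accumulated jumps form a sum over a subset of `J`. Finitely many vertical
translates of one absolutely continuous graph therefore cover the extended graph there. -/
theorem extGraph_subset_iUnion {C : ℝ} {v : ℝ → ℝ} {J : Finset ℝ} {h : ℝ → ℝ}
    (hv : Integrable v) (hae : u =ᵐ[volume.restrict (Ioo a b)] leftRep a C v J h) (N : Set ℝ) :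
    extGraph a b u ∩ {p | p 0 ∈ N \ jumpSet a b u} ⊆
      ⋃ J' : J.powerset, graphMap a (C + ∑ s ∈ J'.1, h s) v '' (Ioo a b ∩ N) := by
  rintro p ⟨hp, hpN, hpJ⟩
  refine mem_iUnion.2 ⟨⟨J.filter (· < p 0), by simp⟩, p 0, ⟨hp.1, hpN⟩, ?_⟩
  rw [graphMap, Finset.sum_filter]
  have h1 := eq_leftTrace_of_mem_extGraph hp hpJ
  rw [leftTrace_eq_leftRep hv hae hp.1, leftRep] at h1
  conv_rhs => rw [← plane_eta p, h1]
  congr 3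
  ring

theorem extGraph_inter_jumpSet_subset :
    extGraph a b u ∩ {p | p 0 ∈ jumpSet a b u} ⊆ ⋃ y : jumpSet a b u,
      (fun t : ℝ => (!₂[(y : ℝ), t] : Plane)) ''
        Icc (min (leftTrace u y) (rightTrace u y)) (max (leftTrace u y) (rightTrace u y)) := by
  rintro p ⟨hp, hpJ⟩
  exact mem_iUnion.2 ⟨⟨p 0, hpJ⟩, p 1, hp.2, plane_eta p⟩

theorem extGraph_subset_union (N : Set ℝ) : extGraph a b u ∩ {p | p 0 ∈ N} ⊆
    (extGraph a b u ∩ {p | p 0 ∈ N \ jumpSet a b u}) ∪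
      (extGraph a b u ∩ {p | p 0 ∈ jumpSet a b u}) := by
  rintro p ⟨hp, hN⟩
  by_cases h : p 0 ∈ jumpSet a b u
  · exact Or.inr ⟨hp, h⟩
  · exact Or.inl ⟨hp, hN, h⟩

theorem isCountablyRectifiable_extGraph (hab : a < b) (hu : IsSBV a b u)
    (hfin : (jumpSet a b u).Finite) : IsCountablyRectifiable (extGraph a b u) := by
  obtain ⟨C, v, J, h, hv, hJ, hae⟩ := hu.exists_leftRep hab hfin
  have h1 : IsCountablyRectifiable (extGraph a b u ∩ {p | p 0 ∈ univ \ jumpSet a b u}) := by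
    choose f hf himg using fun J' : J.powerset =>
      exists_lipschitz_graphMap hv a (C + ∑ s ∈ J'.1, h s) (Ioo a b ∩ univ)
    refine IsCountablyRectifiable.of_countable f _ (fun _ => 1) hf ?_
    simp_rw [himg]
    exact extGraph_subset_iUnion hv hae univ
  have h2 : IsCountablyRectifiable (extGraph a b u ∩ {p | p 0 ∈ jumpSet a b u}) := by
    have := hfin.countable.to_subtype
    exact IsCountablyRectifiable.of_countable _ _ (fun _ => 1)
      (fun y : jumpSet a b u => (isometry_vertical y).lipschitz.lipschitzOnWith)
      extGraph_inter_jumpSet_subset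
  exact (h1.union h2).mono ((subset_inter subset_rfl fun _ _ => trivial).trans
    (extGraph_subset_union univ))

theorem hausdorff_extGraph_lt_top (hab : a < b) (hu : IsSBV a b u)
    (hfin : (jumpSet a b u).Finite) : μH[1] (extGraph a b u) < ∞ := by
  obtain ⟨C, v, J, h, hv, hJ, hae⟩ := hu.exists_leftRep hab hfin
  refine (measure_mono ((subset_inter subset_rfl fun _ _ => trivial).trans
    (extGraph_subset_union univ))).trans_lt ((measure_union_le _ _).trans_lt
      (ENNReal.add_lt_top.2 ⟨?_, ?_⟩))
  · refine (measure_mono (extGraph_subset_iUnion hv hae univ)).trans_lt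
      ((measure_iUnion_fintype_le _ _).trans_lt (ENNReal.sum_lt_top.2 fun J' _ => ?_))
    rw [inter_univ]
    exact hausdorff_graphMap_Ioo_lt_top hv a _ a b
  · have := hfin.fintype
    refine (measure_mono extGraph_inter_jumpSet_subset).trans_lt
      ((measure_iUnion_fintype_le _ _).trans_lt (ENNReal.sum_lt_top.2 fun y _ => ?_))
    rw [(isometry_vertical y).hausdorffMeasure_image (Or.inl zero_le_one), hausdorffMeasure_real]
    simp

/-- The part of an extended graph over a null set of non-jump points is negligible. -/
theorem hausdorff_extGraph_null (hab : a < b) (hu : IsSBV a b u)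
    (hfin : (jumpSet a b u).Finite) {N : Set ℝ} (hN : volume N = 0) :
    μH[1] (extGraph a b u ∩ {p | p 0 ∈ N \ jumpSet a b u}) = 0 := by
  obtain ⟨C, v, J, h, hv, hJ, hae⟩ := hu.exists_leftRep hab hfin
  refine measure_mono_null (extGraph_subset_iUnion hv hae N) (measure_iUnion_null fun J' => ?_)
  refine le_antisymm ((hausdorff_graphMap_le hv a _ _).trans ?_) bot_le
  exact (volume_graphParam_image_null hv a (measure_mono_null inter_subset_right hN)).le

theorem ae_differentiableAt_preciseRep (hab : a < b) (hu : IsSBV a b u)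
    (hfin : (jumpSet a b u).Finite) :
    ∀ᵐ x : ℝ, x ∈ Ioo a b → HasDerivAt (preciseRep u) (apDeriv u x) x := by
  obtain ⟨C, v, J, h, hv, hJ, hae⟩ := hu.exists_leftRep hab hfin
  filter_upwards [LocallyIntegrable.ae_hasDerivAt_integral hv.locallyIntegrable,
    hfin.countable.ae_notMem volume]
    with x hx hxJ hmem
  refine DifferentiableAt.hasDerivAt ?_
  have hev : preciseRep u =ᶠ[𝓝 x] fun z =>
      C + (∫ t in a..z, v t) + ∑ s ∈ J, if s < x then h s else 0 := by
    have h1 : ∀ᶠ z in 𝓝 x, ∀ s ∈ J, (s < z ↔ s < x) := by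
      refine (Finset.eventually_all J).2 fun s hs => ?_
      have hsx : s ≠ x := by
        rintro rfl
        exact hxJ (hJ ▸ hs)
      rcases lt_or_gt_of_ne hsx with h1 | h1
      · filter_upwards [lt_mem_nhds h1] with z hz
        exact ⟨fun _ => h1, fun _ => hz⟩
      · filter_upwards [gt_mem_nhds h1] with z hz
        exact ⟨fun h => absurd h (not_lt_of_gt hz), fun h => absurd h (not_lt_of_gt h1)⟩
    filter_upwards [h1, Ioo_mem_nhds hmem.1 hmem.2,
      hfin.isClosed.isOpen_compl.mem_nhds hxJ] with z hz hzI hzJ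
    rw [preciseRep_eq_leftTrace hzI hzJ, leftTrace_eq_leftRep hv hae hzI, leftRep]
    congr 1
    refine Finset.sum_congr rfl fun s hs => ?_
    simp [hz s hs]
  exact (((hx a).differentiableAt.const_add C).add_const _).congr_of_eventuallyEq hev

theorem hasDerivAt_plane {γ : ℝ → Plane} {γ' : Plane} {s : ℝ} (h : HasDerivAt γ γ' s) (i : Fin 2) :
    HasDerivAt (fun t => γ t i) (γ' i) s :=
  (EuclideanSpace.proj i : Plane →L[ℝ] ℝ).hasFDerivAt.comp_hasDerivAt s h

/-- Over a jump point the horizontal coordinate is constant along an accumulating set of times, so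
the velocity is vertical. Elsewhere `preciseRep u (γ₀) - γ₁` vanishes along such a set, and its
derivative forces the velocity to have the slope of the graph. Points of non-differentiability of
`preciseRep u` carry an `ℋ¹`-null part of the graph, where the velocity vanishes almost always. -/
theorem isTangentTo_extGraph (hab : a < b) (hu : IsSBV a b u)
    (hfin : (jumpSet a b u).Finite) : IsTangentTo (extGraph a b u) (graphOrientation u) := by
  intro K γ hγ
  set N := {x | ¬ (x ∈ Ioo a b → HasDerivAt (preciseRep u) (apDeriv u x) x)}
  have hN : volume N = 0 := ae_differentiableAt_preciseRep hab hu hfin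
  have hjump : ∀ᵐ s : ℝ, ∀ y ∈ jumpSet a b u, γ s 0 = y → (𝓝[{s | γ s 0 = y} ∩ Ioi s] s).NeBot :=
    (ae_ball_iff hfin.countable).2 fun y _ => ae_mem_imp_neBot_right {s | γ s 0 = y}
  set E := {s | γ s ∈ extGraph a b u ∧ γ s 0 ∉ jumpSet a b u}
  filter_upwards [hγ.ae_differentiableAt_real, hjump, ae_mem_imp_neBot_right E,
    ae_deriv_eq_zero_of_hausdorff_null γ (hausdorff_extGraph_null hab hu hfin hN)]
    with s hdiff hs1 hs2 hs3 hmem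
  have hd := hdiff.hasDerivAt
  by_cases hJ : γ s 0 ∈ jumpSet a b u
  · have h0 : deriv γ s 0 = 0 := deriv_eq_zero_of_eq_zero_on (E := {t | γ t 0 = γ s 0})
      ((hasDerivAt_plane hd 0).sub_const (γ s 0)) rfl
      (fun t ht => sub_eq_zero.2 ht) (hs1 _ hJ rfl)
    have hne := hJ.2
    rw [graphOrientation, if_neg hne]
    rcases lt_or_gt_of_ne (sub_ne_zero.2 hne.symm) with h1 | h1
    · refine ⟨-deriv γ s 1, ?_⟩
      rw [sign_neg h1]
      ext i; fin_cases i <;> simp [h0]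
    · refine ⟨deriv γ s 1, ?_⟩
      rw [sign_pos h1]
      ext i; fin_cases i <;> simp [h0]
  · by_cases hNs : γ s 0 ∈ N
    · exact ⟨0, by rw [hs3 ⟨hmem, hNs, hJ⟩, zero_smul]⟩
    · have hder : HasDerivAt (preciseRep u) (apDeriv u (γ s 0)) (γ s 0) := by
        by_contra h
        exact hNs fun h' => h (h' hmem.1)
      have h2 : apDeriv u (γ s 0) * deriv γ s 0 - deriv γ s 1 = 0 :=
        deriv_eq_zero_of_eq_zero_on (E := E)
          ((hder.comp s (hasDerivAt_plane hd 0)).sub (hasDerivAt_plane hd 1)) ⟨hmem, hJ⟩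
          (fun t ht => by
            change preciseRep u (γ t 0) - γ t 1 = 0
            rw [preciseRep_eq_leftTrace ht.1.1 ht.2, eq_leftTrace_of_mem_extGraph ht.1 ht.2,
              sub_self])
          (hs2 ⟨hmem, hJ⟩)
      have hpos : 0 < √(1 + apDeriv u (γ s 0) ^ 2) := Real.sqrt_pos.2 (by positivity)
      refine ⟨deriv γ s 0 * √(1 + apDeriv u (γ s 0) ^ 2), ?_⟩
      rw [graphOrientation, if_pos (leftTrace_eq_rightTrace_of_notMem hmem.1 hJ), smul_smul,
        mul_assoc, mul_inv_cancel₀ hpos.ne', mul_one]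
      ext i
      fin_cases i
      · simp
      · simp; linarith

end Graph

/-! ### Currents as vector fields with respect to the Hausdorff measure -/

section Field

variable {a b : ℝ}

/-- The vector density `θ ξ 1_M` of a rectifiable current. -/
def RectTriple.field (R : RectTriple a b) : Plane → Plane :=
  R.M.indicator fun p => R.θ p • R.ξ p

theorem RectTriple.action_eq_integral_field (R : RectTriple a b) (ω : TestForm a b) :
    R.action ω = ∫ p, ω p (R.field p) ∂μH[1] := by
  rw [RectTriple.action, ← integral_indicator R.measurableSet_M]
  congr 1
  funext p
  by_cases hp : p ∈ R.M <;> simp [RectTriple.field, hp]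

theorem RectTriple.locallyIntegrableOn_field (R : RectTriple a b) :
    LocallyIntegrableOn R.field (strip a b) μH[1] := by
  rw [locallyIntegrableOn_iff (strip a b).isOpen.isLocallyClosed]
  intro Q hQs hQ
  have h1 : IntegrableOn (fun p => R.θ p • R.ξ p) (R.M ∩ Q) μH[1] := by
    refine Integrable.mono (R.integrable_θ Q hQ hQs)
      (R.measurable_θ.smul R.measurable_ξ).aestronglyMeasurable ?_
    filter_upwards [ae_restrict_mem (R.measurableSet_M.inter hQ.measurableSet)] with p hp
    rw [norm_smul, R.norm_ξ p hp.1, mul_one]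
  rw [RectTriple.field, IntegrableOn, integrable_indicator_iff R.measurableSet_M]
  rwa [IntegrableOn, Measure.restrict_restrict R.measurableSet_M]

theorem measurable_coord (i : Fin 2) : Measurable fun p : Plane => p i := by fun_prop

/-- The test form `η dx` (for `i = 0`) or `η dt` (for `i = 1`). -/
def coordForm {η : Plane → ℝ} (hη : ContDiff ℝ (⊤ : ℕ∞) η) (hc : HasCompactSupport η)
    (hs : tsupport η ⊆ strip a b) (i : Fin 2) : TestForm a b where
  toFun p := η p • (EuclideanSpace.proj i : Plane →L[ℝ] ℝ)
  contDiff' := hη.smul contDiff_const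
  hasCompactSupport' := hc.smul_right
  tsupport_subset' := (closure_mono (Function.support_smul_subset_left _ _)).trans hs

/-- Testing with the forms `η dx` and `η dt` reduces this to the fundamental lemma of the calculus
of variations for each coordinate. It is what makes `G` independent of the representing triple. -/
theorem RectTriple.field_ae_eq {R R' : RectTriple a b} (h : R.action = R'.action) :
    R.field =ᵐ[μH[1]] R'.field := by
  have hcoord : ∀ (R : RectTriple a b) (i : Fin 2),
      LocallyIntegrableOn (fun p => R.field p i) (strip a b) μH[1] := by
    intro R i p hp
    obtain ⟨s, hs, hint⟩ := R.locallyIntegrableOn_field p hp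
    exact ⟨s, hs, (EuclideanSpace.proj i : Plane →L[ℝ] ℝ).integrable_comp hint⟩
  have key : ∀ i : Fin 2, ∀ᵐ p ∂(μH[1] : Measure Plane), p ∈ strip a b →
      R.field p i - R'.field p i = 0 := by
    intro i
    refine (strip a b).isOpen.ae_eq_zero_of_integral_contDiff_smul_eq_zero
      ((hcoord R i).sub (hcoord R' i)) fun η hη hc hs => ?_
    have h1 := congrFun h (coordForm hη hc hs i)
    rw [R.action_eq_integral_field, R'.action_eq_integral_field] at h1
    have h2 : ∀ R : RectTriple a b, ∀ p, coordForm hη hc hs i p (R.field p) =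
        η p * R.field p i := fun R p => rfl
    simp_rw [h2] at h1
    have hint : ∀ R : RectTriple a b, Integrable (fun p => η p * R.field p i) μH[1] := by
      intro R
      obtain ⟨B, hB⟩ := hc.exists_bound_of_continuous hη.continuous
      rw [← integrableOn_iff_integrable_of_support_subset (s := tsupport η)]
      · exact Integrable.bdd_mul ((hcoord R i).integrableOn_compact_subset hs hc)
          hη.continuous.aestronglyMeasurable (Eventually.of_forall hB)
      · exact (Function.support_mul_subset_left _ _).trans (subset_tsupport η)
    simp_rw [smul_eq_mul, mul_sub]
    rw [integral_sub (hint R) (hint R'), h1, sub_self]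
  filter_upwards [key 0, key 1] with p h0 h1
  by_cases hp : p ∈ strip a b
  · ext i
    fin_cases i
    · exact sub_eq_zero.1 (h0 hp)
    · exact sub_eq_zero.1 (h1 hp)
  · rw [RectTriple.field, RectTriple.field, indicator_of_notMem fun h => hp (R.subset_strip h),
      indicator_of_notMem fun h => hp (R'.subset_strip h)]

/-- `⟨φ, -⋆X⟩`. -/
def flux (φ X : Plane → Plane) (p : Plane) : ℝ := inner ℝ (φ p) (-hodge (X p))

theorem flux_eq (φ X : Plane → Plane) (p : Plane) :
    flux φ X p = φ p 0 * X p 1 - φ p 1 * X p 0 := by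
  simp [flux, hodge, PiLp.inner_apply, Fin.sum_univ_two]
  ring

/-- The lifted functional of a vector field. -/
def fieldLift (a b α β : ℝ) (g : ℝ → ℝ) (X : Plane → Plane) : EReal :=
  ⨆ φ ∈ {φ ∈ fieldSet a b α β g | Integrable (flux φ X) μH[1]},
    ((∫ p, flux φ X p ∂μH[1] : ℝ) : EReal)

theorem fieldLift_congr {α β : ℝ} {g : ℝ → ℝ} {X Y : Plane → Plane} (h : X =ᵐ[μH[1]] Y) :
    fieldLift a b α β g X = fieldLift a b α β g Y := by
  have h1 : ∀ φ, flux φ X =ᵐ[μH[1]] flux φ Y := fun φ => by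
    filter_upwards [h] with p hp
    rw [flux, flux, hp]
  unfold fieldLift
  simp_rw [fun φ => integrable_congr (h1 φ), fun φ => integral_congr_ae (h1 φ)]

theorem RectTriple.lift_eq_fieldLift (R : RectTriple a b) (α β : ℝ) (g : ℝ → ℝ) :
    R.lift α β g = fieldLift a b α β g R.field := by
  have h1 : ∀ φ, flux φ R.field =
      R.M.indicator fun p => R.θ p * inner ℝ (φ p) (R.normal p) := by
    intro φ
    funext p
    by_cases hp : p ∈ R.M
    · rw [indicator_of_mem hp, flux_eq, RectTriple.field, indicator_of_mem hp]
      simp [RectTriple.normal, hodge, PiLp.inner_apply, Fin.sum_univ_two]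
      ring
    · rw [indicator_of_notMem hp, flux_eq, RectTriple.field, indicator_of_notMem hp]
      simp
  unfold RectTriple.lift fieldLift
  simp_rw [h1, integrable_indicator_iff R.measurableSet_M, integral_indicator R.measurableSet_M]

theorem G_eq_fieldLift (R : RectTriple a b) (α β : ℝ) (g : ℝ → ℝ) :
    G α β g R.action = fieldLift a b α β g R.field := by
  refine le_antisymm (iSup₂_le fun R' hR' => ?_) ?_
  · rw [R'.lift_eq_fieldLift, fieldLift_congr (RectTriple.field_ae_eq hR')]
  · rw [← R.lift_eq_fieldLift]
    exact le_iSup₂ (f := fun (R' : RectTriple a b)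
      (_ : R' ∈ {R' : RectTriple a b | R'.action = R.action}) => R'.lift α β g) R rfl

end Field

/-! ### The current of a weighted family of graphs -/

section Family

variable {a b : ℝ}

theorem integrable_graphField (hab : a < b) {u : ℝ → ℝ} (hu : IsSBV a b u)
    (hfin : (jumpSet a b u).Finite) : Integrable (graphField a b u) μH[1] := by
  have h1 : Integrable ((extGraph a b u).indicator fun _ => (1 : ℝ)) μH[1] := by
    rw [integrable_indicator_iff (measurableSet_extGraph hab hu hfin)]
    exact integrableOn_const (hausdorff_extGraph_lt_top hab hu hfin).ne
  refine h1.mono (measurable_graphField hab hu hfin).aestronglyMeasurable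
    (Eventually.of_forall fun p => ?_)
  by_cases hp : p ∈ extGraph a b u <;> simp [graphField, hp, norm_graphOrientation]

theorem graphCurrent_eq_integral (hab : a < b) {u : ℝ → ℝ} (hu : IsSBV a b u)
    (hfin : (jumpSet a b u).Finite) (ω : TestForm a b) :
    graphCurrent a b u ω = ∫ p, ω p (graphField a b u p) ∂μH[1] := by
  rw [graphCurrent, ← integral_indicator (measurableSet_extGraph hab hu hfin)]
  congr 1
  funext p
  by_cases hp : p ∈ extGraph a b u <;> simp [graphField, hp]

theorem integrable_testForm_apply (ω : TestForm a b) {X : Plane → Plane}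
    (hX : Integrable X μH[1]) : Integrable (fun p => ω p (X p)) μH[1] := by
  obtain ⟨B, hB⟩ := ω.hasCompactSupport.exists_bound_of_continuous ω.continuous
  refine (hX.norm.const_mul B).mono' ?_ (Eventually.of_forall fun p => ?_)
  · exact (isBoundedBilinearMap_apply (𝕜 := ℝ) (E := Plane)
      (F := ℝ)).continuous.comp_aestronglyMeasurable
        (ω.continuous.aestronglyMeasurable.prodMk hX.aestronglyMeasurable)
  · exact ((ω p).le_opNorm _).trans (by gcongr; exact hB p)

variable {ι : Type*} [Fintype ι]

/-- The vector density of the current `∑ i, m i Γ_{w i}`. -/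
def sumField (a b : ℝ) (m : ι → ℝ) (w : ι → ℝ → ℝ) (p : Plane) : Plane :=
  ∑ i, m i • graphField a b (w i) p

variable {m : ι → ℝ} {w : ι → ℝ → ℝ}

theorem measurable_sumField (hab : a < b) (hw : ∀ i, IsSBV a b (w i))
    (hfin : ∀ i, (jumpSet a b (w i)).Finite) : Measurable (sumField a b m w) :=
  Finset.measurable_fun_sum _ fun i _ =>
    Measurable.const_smul (measurable_graphField hab (hw i) (hfin i)) (m i)

theorem integrable_sumField (hab : a < b) (hw : ∀ i, IsSBV a b (w i))
    (hfin : ∀ i, (jumpSet a b (w i)).Finite) : Integrable (sumField a b m w) μH[1] := by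
  unfold sumField
  exact integrable_finsetSum _ fun i _ =>
    Integrable.smul (m i) (integrable_graphField hab (hw i) (hfin i))

theorem sum_graphCurrent_eq_integral (hab : a < b) (hw : ∀ i, IsSBV a b (w i))
    (hfin : ∀ i, (jumpSet a b (w i)).Finite) (ω : TestForm a b) :
    (∑ i, m i • graphCurrent a b (w i)) ω = ∫ p, ω p (sumField a b m w p) ∂μH[1] := by
  simp_rw [sumField, _root_.map_sum, map_smul]
  have hint : ∀ i ∈ Finset.univ, Integrable (fun p => m i • ω p (graphField a b (w i) p)) μH[1] :=
    fun i _ => (integrable_testForm_apply ω (integrable_graphField hab (hw i) (hfin i))).smul (m i)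
  rw [integral_finsetSum _ hint]
  simp_rw [integral_smul, ← fun i => graphCurrent_eq_integral hab (hw i) (hfin i) ω]
  simp

theorem exists_mem_extGraph_of_sumField_ne_zero {p : Plane} (hp : sumField a b m w p ≠ 0) :
    ∃ i, p ∈ extGraph a b (w i) := by
  by_contra! h
  exact hp (Finset.sum_eq_zero fun i _ => by simp [graphField, h i])

/-- The polar decomposition of the vector density of `∑ i, m i Γ_{w i}`. -/
def sumTriple (hab : a < b) (m : ι → ℝ) (hw : ∀ i, IsSBV a b (w i))
    (hfin : ∀ i, (jumpSet a b (w i)).Finite) : RectTriple a b where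
  M := {p | sumField a b m w p ≠ 0}
  θ p := ‖sumField a b m w p‖
  ξ p := ‖sumField a b m w p‖⁻¹ • sumField a b m w p
  subset_strip p hp := by
    obtain ⟨i, hi⟩ := exists_mem_extGraph_of_sumField_ne_zero hp
    exact extGraph_subset_strip a b _ hi
  measurableSet_M := (measurable_sumField hab hw hfin) (measurableSet_singleton 0).compl
  rectifiable := by
    refine (IsCountablyRectifiable.iUnion fun i =>
      isCountablyRectifiable_extGraph hab (hw i) (hfin i)).mono fun p hp => ?_
    exact mem_iUnion.2 (exists_mem_extGraph_of_sumField_ne_zero hp)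
  measurable_θ := (measurable_sumField hab hw hfin).norm
  θ_pos p hp := norm_pos_iff.2 hp
  integrable_θ Q _ _ := (integrable_sumField hab hw hfin).norm.integrableOn
  measurable_ξ := (measurable_sumField hab hw hfin).norm.inv.smul (measurable_sumField hab hw hfin)
  norm_ξ p hp := by
    rw [norm_smul, norm_inv, norm_norm, inv_mul_cancel₀ (norm_ne_zero_iff.2 hp)]
  tangent := by
    intro K γ hγ
    have h := ae_all_iff.2 fun i => isTangentTo_extGraph hab (hw i) (hfin i) K γ hγ
    filter_upwards [h] with s hs hmem
    by_cases h0 : deriv γ s = 0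
    · exact ⟨0, by rw [h0, zero_smul]⟩
    -- At a nonzero velocity every graph through the point has its orientation parallel to that
    -- velocity, so the weighted sum of orientations is parallel to it as well.
    have h1 : ∀ i, ∃ c : ℝ, graphField a b (w i) (γ s) = c • deriv γ s := by
      intro i
      by_cases hi : γ s ∈ extGraph a b (w i)
      · obtain ⟨c, hc⟩ := hs i hi
        have hc0 : c ≠ 0 := by
          rintro rfl
          exact h0 (by rw [hc, zero_smul])
        exact ⟨c⁻¹, by rw [graphField, indicator_of_mem hi, hc, inv_smul_smul₀ hc0]⟩
      · exact ⟨0, by rw [graphField, indicator_of_notMem hi, zero_smul]⟩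
    choose c hc using h1
    have h2 : sumField a b m w (γ s) = (∑ i, m i * c i) • deriv γ s := by
      rw [sumField, Finset.sum_smul]
      exact Finset.sum_congr rfl fun i _ => by rw [hc i, smul_smul]
    have hne : sumField a b m w (γ s) ≠ 0 := hmem
    have h3 : (∑ i, m i * c i) ≠ 0 := by
      intro h'
      exact hne (by rw [h2, h', zero_smul])
    refine ⟨(∑ i, m i * c i)⁻¹ * ‖sumField a b m w (γ s)‖, ?_⟩
    rw [smul_smul, mul_assoc, mul_inv_cancel₀ (norm_ne_zero_iff.2 hne), mul_one]
    rw [h2, inv_smul_smul₀ h3]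

theorem field_sumTriple (hab : a < b) (hw : ∀ i, IsSBV a b (w i))
    (hfin : ∀ i, (jumpSet a b (w i)).Finite) :
    (sumTriple hab m hw hfin).field = sumField a b m w := by
  funext p
  by_cases hp : sumField a b m w p = 0
  · rw [RectTriple.field, indicator_of_notMem, hp]
    exact fun h => h hp
  · rw [RectTriple.field, indicator_of_mem (show p ∈ (sumTriple hab m hw hfin).M from hp)]
    exact smul_inv_smul₀ (norm_ne_zero_iff.2 hp) _

theorem action_sumTriple (hab : a < b) (hw : ∀ i, IsSBV a b (w i))
    (hfin : ∀ i, (jumpSet a b (w i)).Finite) :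
    (sumTriple hab m hw hfin).action = ∑ i, m i • graphCurrent a b (w i) := by
  funext ω
  rw [RectTriple.action_eq_integral_field, field_sumTriple,
    sum_graphCurrent_eq_integral hab hw hfin]

theorem G_sum_graphCurrent (hab : a < b) (hw : ∀ i, IsSBV a b (w i))
    (hfin : ∀ i, (jumpSet a b (w i)).Finite) (α β : ℝ) (g : ℝ → ℝ) :
    G α β g (∑ i, m i • graphCurrent a b (w i)) = fieldLift a b α β g (sumField a b m w) := by
  rw [← action_sumTriple hab hw hfin, G_eq_fieldLift, field_sumTriple]

end Family

/-! ### The flux through an extended graph -/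

section Flux

variable {a b : ℝ} {u : ℝ → ℝ}

/-- The difference of two step functions holds for upward, downward and absent jumps alike, and
separates the contributions of the two traces. This is why repasting at `y` does not change the
current. -/
theorem graphField_vertical {y t : ℝ} (hy : y ∈ Ioo a b) (hl : t ≠ leftTrace u y)
    (hr : t ≠ rightTrace u y) : graphField a b u !₂[y, t] =
      !₂[0, (if leftTrace u y < t then 1 else 0) - (if rightTrace u y < t then 1 else 0)] := by
  have hmem : !₂[y, t] ∈ extGraph a b u ↔ min (leftTrace u y) (rightTrace u y) ≤ t ∧
      t ≤ max (leftTrace u y) (rightTrace u y) := ⟨fun h => h.2, fun h => ⟨hy, h⟩⟩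
  have hor : graphOrientation u !₂[y, t] = if leftTrace u y = rightTrace u y then
      (√(1 + apDeriv u y ^ 2))⁻¹ • !₂[1, apDeriv u y]
      else !₂[0, (SignType.sign (rightTrace u y - leftTrace u y) : ℝ)] := rfl
  unfold graphField
  by_cases h : !₂[y, t] ∈ extGraph a b u
  · rw [indicator_of_mem h, hor]
    have h' := hmem.1 h
    have hne : leftTrace u y ≠ rightTrace u y := by
      intro he
      rw [← he, min_self, max_self] at h'
      exact hl (le_antisymm h'.2 h'.1)
    rw [if_neg hne]
    rcases lt_or_gt_of_ne hne with hlt | hlt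
    · rw [min_eq_left hlt.le, max_eq_right hlt.le] at h'
      rw [sign_pos (sub_pos.2 hlt), if_pos (lt_of_le_of_ne h'.1 hl.symm), if_neg h'.2.not_gt]
      simp
    · rw [min_eq_right hlt.le, max_eq_left hlt.le] at h'
      rw [sign_neg (sub_neg.2 hlt), if_pos (lt_of_le_of_ne h'.1 hr.symm), if_neg h'.2.not_gt]
      simp
  · rw [indicator_of_notMem h]
    rw [hmem, not_and_or, not_le, not_le, lt_min_iff, max_lt_iff] at h
    rcases h with h | h
    · rw [if_neg h.1.not_gt, if_neg h.2.not_gt]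
      ext i; fin_cases i <;> simp
    · rw [if_pos h.1, if_pos h.2]
      ext i; fin_cases i <;> simp

theorem flux_graphField_vertical_ae (φ : Plane → Plane) {y : ℝ} (hy : y ∈ Ioo a b) :
    (fun t => flux φ (graphField a b u) !₂[y, t]) =ᵐ[volume] fun t =>
      (Ioc (leftTrace u y) (rightTrace u y)).indicator (fun t => φ !₂[y, t] 0) t -
      (Ioc (rightTrace u y) (leftTrace u y)).indicator (fun t => φ !₂[y, t] 0) t := by
  filter_upwards [(countable_singleton (leftTrace u y)).ae_notMem volume,
    (countable_singleton (rightTrace u y)).ae_notMem volume] with t hl hr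
  rw [flux_eq, graphField_vertical hy hl hr]
  simp only [indicator_apply, mem_Ioc, Matrix.cons_val_zero, Matrix.cons_val_one]
  rcases lt_or_gt_of_ne hl with h1 | h1 <;> rcases lt_or_gt_of_ne hr with h2 | h2 <;>
    simp [h1, h2, h1.le, h2.le, h1.not_gt, h2.not_gt, h1.not_ge, h2.not_ge]

theorem integrableOn_flux_vertical {φ : Plane → Plane} {y : ℝ} (hy : y ∈ Ioo a b)
    (hφ : IntervalIntegrable (fun t => φ !₂[y, t] 0) volume (leftTrace u y) (rightTrace u y)) :
    IntegrableOn (flux φ (graphField a b u)) {p | p 0 = y} μH[1] := by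
  rw [IntegrableOn, ← map_vertical, (measurableEmbedding_vertical y).integrable_map_iff]
  refine Integrable.congr ?_ (flux_graphField_vertical_ae φ hy).symm
  exact ((integrable_indicator_iff measurableSet_Ioc).2 hφ.1).sub
    ((integrable_indicator_iff measurableSet_Ioc).2 hφ.2)

theorem integral_flux_vertical {φ : Plane → Plane} {y : ℝ} (hy : y ∈ Ioo a b)
    (hφ : IntervalIntegrable (fun t => φ !₂[y, t] 0) volume (leftTrace u y) (rightTrace u y)) :
    ∫ p in {p | p 0 = y}, flux φ (graphField a b u) p ∂μH[1] =
      ∫ t in (leftTrace u y)..(rightTrace u y), φ !₂[y, t] 0 := by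
  rw [← map_vertical, (measurableEmbedding_vertical y).integral_map,
    integral_congr_ae (flux_graphField_vertical_ae φ hy), integral_sub
      ((integrable_indicator_iff measurableSet_Ioc).2 hφ.1)
      ((integrable_indicator_iff measurableSet_Ioc).2 hφ.2),
    integral_indicator measurableSet_Ioc, integral_indicator measurableSet_Ioc]
  rfl

theorem graphField_of_mem {p : Plane} (hp : p ∈ extGraph a b u) (hJ : p 0 ∉ jumpSet a b u) :
    graphField a b u p = (√(1 + apDeriv u (p 0) ^ 2))⁻¹ • !₂[1, apDeriv u (p 0)] := by
  rw [graphField, indicator_of_mem hp, graphOrientation,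
    if_pos (leftTrace_eq_rightTrace_of_notMem hp.1 hJ)]

theorem flux_graphField_of_mem (φ : Plane → Plane) {p : Plane} (hp : p ∈ extGraph a b u)
    (hJ : p 0 ∉ jumpSet a b u) : flux φ (graphField a b u) p =
      (φ p 0 * apDeriv u (p 0) - φ p 1) / √(1 + apDeriv u (p 0) ^ 2) := by
  rw [flux_eq, graphField_of_mem hp hJ]
  simp only [PiLp.smul_apply, smul_eq_mul, Matrix.cons_val_zero, Matrix.cons_val_one]
  ring

theorem flux_graphField_of_notMem (φ : Plane → Plane) {p : Plane} (hp : p ∉ extGraph a b u) :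
    flux φ (graphField a b u) p = 0 := by
  rw [flux_eq, graphField, indicator_of_notMem hp]
  simp

/-- The integrand of the Mumford-Shah functional per unit length of the graph of `u`. -/
def energyDensity (β : ℝ) (g u : ℝ → ℝ) (p : Plane) : ℝ :=
  (apDeriv u (p 0) ^ 2 + β * (p 1 - g (p 0)) ^ 2) / √(1 + apDeriv u (p 0) ^ 2)

theorem energyDensity_nonneg {β : ℝ} (hβ : 0 ≤ β) (g u : ℝ → ℝ) (p : Plane) :
    0 ≤ energyDensity β g u p := by
  unfold energyDensity
  positivity

theorem measurable_fidelity (β : ℝ) {g : ℝ → ℝ} (hg : Measurable g) :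
    Measurable fun p : Plane => β * (p 1 - g (p 0)) ^ 2 :=
  (((measurable_coord 1).sub (hg.comp (measurable_coord 0))).pow_const 2).const_mul β

theorem measurable_energyDensity (β : ℝ) {g : ℝ → ℝ} (hg : Measurable g) (u : ℝ → ℝ) :
    Measurable (energyDensity β g u) := by
  have hd := ((measurable_apDeriv u).comp (measurable_coord 0)).pow_const 2
  exact (hd.add (measurable_fidelity β hg)).div (measurable_const.add hd).sqrt

/-- By the constraint on `φᵗ`, `φˣ u' - φᵗ ≤ φˣ u' - (φˣ)²/4 + β(t - g)²`; completing the square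
bounds this by `u'² + β(t - g)²`. Equality in the square means `φˣ = 2u'`. -/
theorem flux_le_energyDensity {β : ℝ} {g : ℝ → ℝ} {φ : Plane → Plane} {p : Plane}
    (hφ : (φ p 0) ^ 2 / 4 - β * (p 1 - g (p 0)) ^ 2 ≤ φ p 1) (hp : p ∈ extGraph a b u)
    (hJ : p 0 ∉ jumpSet a b u) :
    flux φ (graphField a b u) p ≤ energyDensity β g u p := by
  rw [flux_graphField_of_mem φ hp hJ, energyDensity]
  gcongr
  nlinarith [sq_nonneg (φ p 0 / 2 - apDeriv u (p 0))]

/-- The Mumford-Shah functional, with the jumps counted in the finite set `S`. -/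
def mumfordShah (a b α β : ℝ) (g : ℝ → ℝ) (S : Finset ℝ) (u : ℝ → ℝ) : ℝ≥0∞ :=
  (∫⁻ p in extGraph a b u ∩ {p | p 0 ∉ S}, ENNReal.ofReal (energyDensity β g u p) ∂μH[1]) +
    ∑ y ∈ S, if leftTrace u y = rightTrace u y then 0 else ENNReal.ofReal α

end Flux

/-! ### Upper bound of the lift by the weighted Mumford-Shah energies -/

section Value

variable {a b : ℝ} {ι : Type*} [Fintype ι] {m : ι → ℝ} {w : ι → ℝ → ℝ}

theorem flux_sumField (φ : Plane → Plane) (p : Plane) :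
    flux φ (sumField a b m w) p = ∑ i, m i * flux φ (graphField a b (w i)) p := by
  simp only [flux_eq, sumField, WithLp.ofLp_sum, WithLp.ofLp_smul, Finset.sum_apply, Pi.smul_apply,
    smul_eq_mul, Finset.mul_sum]
  rw [← Finset.sum_sub_distrib]
  exact Finset.sum_congr rfl fun i _ => by ring

theorem measurableSet_notMem (S : Finset ℝ) : MeasurableSet {p : Plane | p 0 ∉ S} :=
  (measurable_coord 0) S.measurableSet.compl

theorem measurableSet_line (y : ℝ) : MeasurableSet {p : Plane | p 0 = y} :=
  (measurable_coord 0) (measurableSet_singleton y)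

theorem compl_notMem_eq (S : Finset ℝ) :
    {p : Plane | p 0 ∉ S}ᶜ = ⋃ y ∈ S, {p : Plane | p 0 = y} := by
  ext p; simp

theorem integral_split (S : Finset ℝ) {F : Plane → ℝ} (hF : Integrable F μH[1]) :
    ∫ p, F p ∂μH[1] = (∫ p in {p | p 0 ∉ S}, F p ∂μH[1]) +
      ∑ y ∈ S, ∫ p in {p | p 0 = y}, F p ∂μH[1] := by
  rw [← integral_add_compl (measurableSet_notMem S) hF, compl_notMem_eq,
    integral_biUnion_finset S (fun y _ => measurableSet_line y) ?_ fun y _ => hF.integrableOn]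
  intro y _ z _ hyz
  exact Set.disjoint_left.2 fun p hp hp' => hyz ((hp : p 0 = y).symm.trans hp')

theorem integrable_of_split (S : Finset ℝ) {F : Plane → ℝ}
    (h1 : IntegrableOn F {p | p 0 ∉ S} μH[1])
    (h2 : ∀ y ∈ S, IntegrableOn F {p | p 0 = y} μH[1]) : Integrable F μH[1] := by
  rw [← integrableOn_univ, ← union_compl_self {p : Plane | p 0 ∉ S}, compl_notMem_eq]
  exact h1.union ((integrableOn_finset_iUnion).2 h2)

theorem integral_flux_sumField_line {φ : Plane → Plane} {y : ℝ} (hy : y ∈ Ioo a b)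
    (hφ : ∀ t₁ t₂, IntervalIntegrable (fun t => φ !₂[y, t] 0) volume t₁ t₂) :
    ∫ p in {p | p 0 = y}, flux φ (sumField a b m w) p ∂μH[1] =
      ∑ i, m i * ∫ t in (leftTrace (w i) y)..(rightTrace (w i) y), φ !₂[y, t] 0 := by
  simp_rw [flux_sumField]
  rw [integral_finsetSum _ fun i _ => (integrableOn_flux_vertical hy (hφ _ _)).const_mul (m i)]
  exact Finset.sum_congr rfl fun i _ => by
    rw [integral_const_mul, integral_flux_vertical hy (hφ _ _)]

theorem coe_integral_le_lintegral {X : Type*} [MeasurableSpace X] {μ : Measure X} {f : X → ℝ}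
    (hf : Integrable f μ) :
    ((∫ x, f x ∂μ : ℝ) : EReal) ≤ ((∫⁻ x, ENNReal.ofReal (f x) ∂μ : ℝ≥0∞) : EReal) := by
  have hfin : ∫⁻ x, ENNReal.ofReal (f x) ∂μ ≠ ∞ :=
    ((lintegral_mono fun x => Real.ofReal_le_enorm (f x)).trans_lt hf.2).ne
  rw [← ENNReal.ofReal_toReal hfin, EReal.coe_ennreal_ofReal, max_eq_left ENNReal.toReal_nonneg,
    EReal.coe_le_coe_iff, integral_eq_lintegral_pos_part_sub_lintegral_neg_part hf]
  linarith [ENNReal.toReal_nonneg (a := ∫⁻ x, ENNReal.ofReal (-f x) ∂μ)]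

theorem sum_mumfordShah_eq {α β : ℝ} (hα : 0 ≤ α) {g : ℝ → ℝ} {S : Finset ℝ}
    (hm : ∀ i, 0 ≤ m i) :
    ∑ i, ENNReal.ofReal (m i) * mumfordShah a b α β g S (w i) =
      (∑ i, ENNReal.ofReal (m i) * ∫⁻ p in extGraph a b (w i) ∩ {p | p 0 ∉ S},
        ENNReal.ofReal (energyDensity β g (w i) p) ∂μH[1]) +
      ENNReal.ofReal (∑ y ∈ S, ∑ i, m i *
        if leftTrace (w i) y = rightTrace (w i) y then 0 else α) := by
  have h1 : ∀ y i, 0 ≤ m i * (if leftTrace (w i) y = rightTrace (w i) y then 0 else α) := by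
    intro y i
    refine mul_nonneg (hm i) ?_
    split_ifs <;> simp [hα]
  simp_rw [mumfordShah, mul_add]
  rw [Finset.sum_add_distrib, ENNReal.ofReal_sum_of_nonneg fun y _ =>
    Finset.sum_nonneg fun i _ => h1 y i]
  congr 1
  simp_rw [ENNReal.ofReal_sum_of_nonneg fun i _ => h1 _ i, Finset.mul_sum]
  rw [Finset.sum_comm]
  refine Finset.sum_congr rfl fun y _ => Finset.sum_congr rfl fun i _ => ?_
  rw [ENNReal.ofReal_mul (hm i)]
  split_ifs <;> simp

/-- The bound holds graph by graph for every admissible field, whatever the relative position of the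
jumps: the Young inequality off `S`, and the constraint `|∫ φˣ dt| ≤ α` on each vertical segment.
The fidelity term may use `g₀` because the graphs over the null set `N`, off their jumps, are
`ℋ¹`-null. -/
theorem fieldLift_le (hab : a < b) (hw : ∀ i, IsSBV a b (w i))
    (hfin : ∀ i, (jumpSet a b (w i)).Finite) (hm : ∀ i, 0 ≤ m i) {α β : ℝ} (hα : 0 ≤ α)
    (hβ : 0 ≤ β)
    {g g₀ : ℝ → ℝ} (hg₀ : Measurable g₀) {N : Set ℝ} (hN : volume N = 0)
    (hgN : ∀ x ∈ Ioo a b, x ∉ N → g x = g₀ x) {S : Finset ℝ} (hSI : (S : Set ℝ) ⊆ Ioo a b)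
    (hS : ∀ i, jumpSet a b (w i) ⊆ S) :
    fieldLift a b α β g (sumField a b m w) ≤
      ((∑ i, ENNReal.ofReal (m i) * mumfordShah a b α β g₀ S (w i) : ℝ≥0∞) : EReal) := by
  refine iSup₂_le fun φ hφ => ?_
  obtain ⟨⟨-, hφ1, hφ2⟩, hint⟩ := hφ
  rw [integral_split S hint, sum_mumfordShah_eq hα hm, EReal.coe_add, EReal.coe_ennreal_add]
  refine add_le_add ?_ ?_
  · refine (coe_integral_le_lintegral hint.integrableOn).trans ?_
    rw [EReal.coe_ennreal_le_coe_ennreal_iff]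
    have h1 : ∀ i, ENNReal.ofReal (m i) * ∫⁻ p in extGraph a b (w i) ∩ {p | p 0 ∉ S},
        ENNReal.ofReal (energyDensity β g₀ (w i) p) ∂μH[1] = ∫⁻ p in {p | p 0 ∉ S},
        ENNReal.ofReal (m i) * (extGraph a b (w i)).indicator
          (fun p => ENNReal.ofReal (energyDensity β g₀ (w i) p)) p ∂μH[1] := by
      intro i
      have hmeas := measurableSet_extGraph hab (hw i) (hfin i)
      rw [lintegral_const_mul _ ((measurable_energyDensity β hg₀ (w i)).ennreal_ofReal.indicator
        hmeas), lintegral_indicator hmeas, Measure.restrict_restrict hmeas]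
    simp_rw [h1]
    rw [← lintegral_finsetSum]
    swap
    · intro i _
      exact ((measurable_energyDensity β hg₀ (w i)).ennreal_ofReal.indicator
        (measurableSet_extGraph hab (hw i) (hfin i))).const_mul _
    refine lintegral_mono_ae ?_
    have hnull : ∀ᵐ p ∂(μH[1] : Measure Plane), ∀ i,
        p ∉ extGraph a b (w i) ∩ {p | p 0 ∈ N \ jumpSet a b (w i)} :=
      ae_all_iff.2 fun i => measure_eq_zero_iff_ae_notMem.1
        (hausdorff_extGraph_null hab (hw i) (hfin i) hN)
    filter_upwards [ae_restrict_of_ae hnull, ae_restrict_mem (measurableSet_notMem S)] with p hp hpS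
    have h2 : flux φ (sumField a b m w) p ≤ ∑ i, m i * (extGraph a b (w i)).indicator
        (fun p => energyDensity β g₀ (w i) p) p := by
      rw [flux_sumField]
      refine Finset.sum_le_sum fun i _ => mul_le_mul_of_nonneg_left ?_ (hm i)
      by_cases hpi : p ∈ extGraph a b (w i)
      · rw [indicator_of_mem hpi]
        have hJ : p 0 ∉ jumpSet a b (w i) := fun h => hpS (hS i h)
        have hpN : p 0 ∉ N := fun h => hp i ⟨hpi, h, hJ⟩
        refine flux_le_energyDensity ?_ hpi hJ
        rw [← hgN _ hpi.1 hpN]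
        have := hφ1 (p 0) hpi.1 (p 1)
        rwa [plane_eta] at this
      · rw [indicator_of_notMem hpi, flux_graphField_of_notMem φ hpi]
    refine (ENNReal.ofReal_le_ofReal h2).trans (le_of_eq ?_)
    rw [ENNReal.ofReal_sum_of_nonneg fun i _ => mul_nonneg (hm i)
      (indicator_nonneg (fun p _ => energyDensity_nonneg hβ g₀ (w i) p) p)]
    refine Finset.sum_congr rfl fun i _ => ?_
    rw [ENNReal.ofReal_mul (hm i)]
    by_cases hpi : p ∈ extGraph a b (w i) <;> simp [hpi]
  · rw [EReal.coe_ennreal_ofReal, EReal.coe_le_coe_iff]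
    refine le_trans (Finset.sum_le_sum fun y hy => ?_) (le_max_left _ _)
    rw [integral_flux_sumField_line (hSI hy) fun t₁ t₂ => (hφ2 y (hSI hy) t₁ t₂).1]
    refine Finset.sum_le_sum fun i _ => mul_le_mul_of_nonneg_left ?_ (hm i)
    split_ifs with h
    · rw [h, intervalIntegral.integral_same]
    · exact (le_abs_self _).trans (hφ2 y (hSI hy) _ _).2

end Value

/-! ### Almost optimal fields -/

section Calibration

variable {a b : ℝ} {ι : Type*} [Fintype ι] {m : ι → ℝ} {w : ι → ℝ → ℝ}

open scoped Manifold in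
/-- A density on a vertical line which is optimal for all the jumps at `y`, provided that no jump
starts where another one ends. -/
theorem exists_jump_density {α : ℝ} (hα : 0 ≤ α) (l r : ι → ℝ)
    (h : ∀ i j, l i ≠ r i → l j ≠ r j → l i ≠ r j) :
    ∃ ζ : ℝ → ℝ, Continuous ζ ∧ (∀ t₁ t₂, |∫ t in t₁..t₂, ζ t| ≤ α) ∧
      ∀ i, ∫ t in (l i)..(r i), ζ t = if l i = r i then 0 else α := by
  have hA : IsClosed (l '' {i | l i ≠ r i}) := (Set.toFinite _).isClosed
  have hB : IsClosed (r '' {i | l i ≠ r i}) := (Set.toFinite _).isClosed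
  have hdisj : Disjoint (l '' {i | l i ≠ r i}) (r '' {i | l i ≠ r i}) := by
    rw [Set.disjoint_left]
    rintro _ ⟨i, hi, rfl⟩ ⟨j, hj, hij⟩
    exact h i j hi hj hij.symm
  -- A smooth Urysohn function, `0` at departures and `1` at arrivals. Its values lie in `[0, 1]`,
  -- so integrals of `α ψ'` over any interval are at most `α` in absolute value, while each jump
  -- collects exactly `α`.
  obtain ⟨ψ, hψ0, hψ1, hψ⟩ :=
    exists_contMDiffMap_zero_one_of_isClosed (n := (⊤ : ℕ∞)) 𝓘(ℝ, ℝ) hA hB hdisj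
  have hcd : ContDiff ℝ 1 ψ := (ψ.contMDiff.contDiff).of_le (by exact_mod_cast le_top)
  have hcont : Continuous (deriv ψ) := hcd.continuous_deriv le_rfl
  have hint : ∀ t₁ t₂, ∫ t in t₁..t₂, α * deriv ψ t = α * (ψ t₂ - ψ t₁) := by
    intro t₁ t₂
    rw [intervalIntegral.integral_const_mul, intervalIntegral.integral_eq_sub_of_hasDerivAt
      (fun x _ => (hcd.differentiable one_ne_zero x).hasDerivAt) (hcont.intervalIntegrable _ _)]
  refine ⟨fun t => α * deriv ψ t, continuous_const.mul hcont, fun t₁ t₂ => ?_, fun i => ?_⟩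
  · rw [hint, abs_mul, abs_of_nonneg hα]
    refine mul_le_of_le_one_right hα (abs_le.2 ⟨?_, ?_⟩)
    · linarith [(hψ t₂).1, (hψ t₁).2]
    · linarith [(hψ t₂).2, (hψ t₁).1]
  · rw [hint]
    split_ifs with hi
    · simp [hi]
    · have h0 : ψ (l i) = 0 := hψ0 (mem_image_of_mem l hi)
      have h1 : ψ (r i) = 1 := hψ1 (mem_image_of_mem r hi)
      rw [h0, h1]; ring

/-- At almost every point where two graphs cross, they have the same slope. -/
theorem ae_apDeriv_eq (hab : a < b) {u v : ℝ → ℝ} (hu : IsSBV a b u) (hv : IsSBV a b v)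
    {S : Finset ℝ} (hSu : jumpSet a b u ⊆ S) (hSv : jumpSet a b v ⊆ S) :
    ∀ᵐ x : ℝ, x ∈ Ioo a b → x ∉ S → leftTrace u x = leftTrace v x →
      apDeriv u x = apDeriv v x := by
  set E := {x | x ∈ Ioo a b ∧ x ∉ S ∧ leftTrace u x = leftTrace v x}
  filter_upwards [ae_differentiableAt_preciseRep hab hu (S.finite_toSet.subset hSu),
    ae_differentiableAt_preciseRep hab hv (S.finite_toSet.subset hSv),
    ae_mem_imp_neBot_right E] with x hxu hxv hacc hx hxS heq
  refine sub_eq_zero.1 (deriv_eq_zero_of_eq_zero_on (E := E) ((hxu hx).sub (hxv hx))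
    ⟨hx, hxS, heq⟩ (fun t ht => ?_) (hacc ⟨hx, hxS, heq⟩))
  rw [Pi.sub_apply, preciseRep_eq_leftTrace ht.1 fun h => ht.2.1 (hSu h),
    preciseRep_eq_leftTrace ht.1 fun h => ht.2.1 (hSv h), ht.2.2, sub_self]

/-- The slope of the current `∑ i, m i Γ_{w i}`. -/
def sumSlope (a b : ℝ) (m : ι → ℝ) (w : ι → ℝ → ℝ) (p : Plane) : ℝ :=
  sumField a b m w p 1 / sumField a b m w p 0

theorem measurable_sumSlope (hab : a < b) (hw : ∀ i, IsSBV a b (w i))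
    (hfin : ∀ i, (jumpSet a b (w i)).Finite) : Measurable (sumSlope a b m w) :=
  ((measurable_coord 1).comp (measurable_sumField hab hw hfin)).div
    ((measurable_coord 0).comp (measurable_sumField hab hw hfin))

theorem sumSlope_eq_zero {p : Plane} (hp : ∀ i, p ∉ extGraph a b (w i)) :
    sumSlope a b m w p = 0 := by
  have : sumField a b m w p = 0 := by
    by_contra h
    obtain ⟨i, hi⟩ := exists_mem_extGraph_of_sumField_ne_zero h
    exact hp i hi
  simp [sumSlope, this]

/-- Off an `ℋ¹`-null set all graphs through `p` share one slope, so the vertical component of the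
sum is that slope times the horizontal one, which is positive because the weights are. -/
theorem sumSlope_ae_eq (hab : a < b) (hw : ∀ i, IsSBV a b (w i)) (hm : ∀ i, 0 < m i)
    {S : Finset ℝ} (hS : ∀ i, jumpSet a b (w i) ⊆ S) :
    ∀ᵐ p ∂(μH[1] : Measure Plane), p 0 ∉ S → ∀ i, p ∈ extGraph a b (w i) →
      sumSlope a b m w p = apDeriv (w i) (p 0) := by
  have hae : ∀ᵐ x : ℝ, ∀ i j, x ∈ Ioo a b → x ∉ S → leftTrace (w i) x = leftTrace (w j) x →
      apDeriv (w i) x = apDeriv (w j) x :=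
    ae_all_iff.2 fun i => ae_all_iff.2 fun j => ae_apDeriv_eq hab (hw i) (hw j) (hS i) (hS j)
  obtain ⟨N, hN, hNsub⟩ : ∃ N : Set ℝ, volume N = 0 ∧ ∀ x ∉ N, ∀ i j, x ∈ Ioo a b → x ∉ S →
      leftTrace (w i) x = leftTrace (w j) x → apDeriv (w i) x = apDeriv (w j) x :=
    ⟨_, hae, fun x hx => not_not.1 hx⟩
  have hnull : ∀ᵐ p ∂(μH[1] : Measure Plane), ∀ i,
      p ∉ extGraph a b (w i) ∩ {p | p 0 ∈ N \ jumpSet a b (w i)} :=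
    ae_all_iff.2 fun i => measure_eq_zero_iff_ae_notMem.1
      (hausdorff_extGraph_null hab (hw i) (S.finite_toSet.subset (hS i)) hN)
  filter_upwards [hnull] with p hp hpS i hpi
  have hJ : ∀ j, p 0 ∉ jumpSet a b (w j) := fun j h => hpS (hS j h)
  have hgood : ∀ j, p ∈ extGraph a b (w j) → apDeriv (w j) (p 0) = apDeriv (w i) (p 0) := by
    intro j hpj
    exact hNsub _ (fun h => hp i ⟨hpi, h, hJ i⟩) j i hpi.1 hpS (by
      rw [← eq_leftTrace_of_mem_extGraph hpi (hJ i), ← eq_leftTrace_of_mem_extGraph hpj (hJ j)])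
  have h1 : ∀ j, graphField a b (w j) p 1 = apDeriv (w i) (p 0) * graphField a b (w j) p 0 := by
    intro j
    by_cases hpj : p ∈ extGraph a b (w j)
    · rw [graphField_of_mem hpj (hJ j), hgood j hpj]
      simp [mul_comm]
    · simp [graphField, hpj]
  have h2 : ∀ j, 0 ≤ graphField a b (w j) p 0 := by
    intro j
    by_cases hpj : p ∈ extGraph a b (w j)
    · rw [graphField_of_mem hpj (hJ j)]
      simp
    · simp [graphField, hpj]
  have h3 : 0 < graphField a b (w i) p 0 := by
    rw [graphField_of_mem hpi (hJ i)]
    have : 0 < 1 + apDeriv (w i) (p 0) ^ 2 := by positivity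
    simpa using this
  have h4 : ∀ k : Fin 2, sumField a b m w p k = ∑ j, m j * graphField a b (w j) p k := by
    intro k
    simp [sumField]
  have h5 : 0 < sumField a b m w p 0 := by
    rw [h4]
    exact Finset.sum_pos' (fun j _ => mul_nonneg (hm j).le (h2 j))
      ⟨i, Finset.mem_univ i, mul_pos (hm i) h3⟩
  rw [sumSlope, div_eq_iff h5.ne', h4, h4, Finset.mul_sum]
  exact Finset.sum_congr rfl fun j _ => by rw [h1]; ring

/-- The part of the optimal field over the non-jump points, truncated where the energy exceeds
`n`. -/
def regularField (q : Plane → ℝ) (β : ℝ) (g : ℝ → ℝ) (N : Set ℝ) (n : ℕ) : Plane → Plane :=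
  {p : Plane | p 0 ∉ N ∧ q p ^ 2 + β * (p 1 - g (p 0)) ^ 2 ≤ n}.indicator fun p =>
    !₂[2 * q p, q p ^ 2 - β * (p 1 - g (p 0)) ^ 2]

theorem measurable_regularField {q : Plane → ℝ} (hq : Measurable q) (β : ℝ) {g : ℝ → ℝ}
    (hg : Measurable g) {N : Set ℝ} (hN : MeasurableSet N) (n : ℕ) :
    Measurable (regularField q β g N n) :=
  (measurable_plane (hq.const_mul 2) ((hq.pow_const 2).sub (measurable_fidelity β hg))).indicator
    (((measurable_coord 0) hN.compl).inter
      (measurableSet_le ((hq.pow_const 2).add (measurable_fidelity β hg)) measurable_const))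

/-- The almost optimal field: `regularField` over the non-jump points and the densities `ζ` on the
vertical lines over `S`. -/
def calibration (q : Plane → ℝ) (β : ℝ) (g : ℝ → ℝ) (N : Set ℝ) (S : Finset ℝ) (ζ : ℝ → ℝ → ℝ)
    (n : ℕ) : Plane → Plane :=
  fun p => if p 0 ∈ S then !₂[∑ y ∈ S, if p 0 = y then ζ y (p 1) else 0,
      (∑ y ∈ S, if p 0 = y then ζ y (p 1) else 0) ^ 2 / 4]
    else regularField q β g N n p

theorem calibration_of_mem {q : Plane → ℝ} {β : ℝ} {g : ℝ → ℝ} {N : Set ℝ} {S : Finset ℝ}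
    {ζ : ℝ → ℝ → ℝ} {n : ℕ} {y t : ℝ} (hy : y ∈ S) :
    calibration q β g N S ζ n !₂[y, t] = !₂[ζ y t, ζ y t ^ 2 / 4] := by
  simp [calibration, hy]

theorem calibration_of_notMem {q : Plane → ℝ} {β : ℝ} {g : ℝ → ℝ} {N : Set ℝ} {S : Finset ℝ}
    {ζ : ℝ → ℝ → ℝ} {n : ℕ} {p : Plane} (hp : p 0 ∉ S) :
    calibration q β g N S ζ n p = regularField q β g N n p := by
  simp [calibration, hp]

theorem measurable_calibration {q : Plane → ℝ} (hq : Measurable q) (β : ℝ) {g : ℝ → ℝ}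
    (hg : Measurable g) {N : Set ℝ} (hN : MeasurableSet N) (S : Finset ℝ) {ζ : ℝ → ℝ → ℝ}
    (hζ : ∀ y, Continuous (ζ y)) (n : ℕ) : Measurable (calibration q β g N S ζ n) := by
  have hZ : Measurable fun p : Plane => ∑ y ∈ S, if p 0 = y then ζ y (p 1) else 0 :=
    Finset.measurable_fun_sum _ fun y _ => Measurable.ite (measurableSet_line y)
      ((hζ y).measurable.comp (measurable_coord 1)) measurable_const
  exact Measurable.ite ((measurable_coord 0) S.measurableSet)
    (measurable_plane hZ ((hZ.pow_const 2).div_const 4)) (measurable_regularField hq β hg hN n)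

/-- On the graphs over good points the first constraint is an equality. Where the regular field is
cut to zero, and over `S` where `φᵗ = (φˣ)²/4`, it holds because the fidelity term is nonnegative.
-/
theorem calibration_mem_fieldSet (hab : a < b) (hw : ∀ i, IsSBV a b (w i)) {α β : ℝ}
    (hα : 0 ≤ α) (hβ : 0 ≤ β) {g g₀ : ℝ → ℝ} (hg₀ : Measurable g₀) {N : Set ℝ}
    (hNm : MeasurableSet N) (hgN : ∀ x ∈ Ioo a b, x ∉ N → g x = g₀ x) {S : Finset ℝ}
    (hS : ∀ i, jumpSet a b (w i) ⊆ S) {ζ : ℝ → ℝ → ℝ} (hζ : ∀ y, Continuous (ζ y))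
    (hζα : ∀ y, ∀ t₁ t₂, |∫ t in t₁..t₂, ζ y t| ≤ α) (n : ℕ) :
    calibration (sumSlope a b m w) β g₀ N S ζ n ∈ fieldSet a b α β g := by
  have hfin := fun i => S.finite_toSet.subset (hS i)
  refine ⟨measurable_calibration (measurable_sumSlope hab hw hfin) β hg₀ hNm S hζ n, ?_, ?_⟩
  · intro x hx t
    have hfid : 0 ≤ β * (t - g x) ^ 2 := by positivity
    by_cases hxS : x ∈ S
    · rw [calibration_of_mem hxS]
      simpa using hfid
    · rw [calibration_of_notMem (by exact hxS), regularField]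
      by_cases hmem : !₂[x, t] ∈ {p : Plane | p 0 ∉ N ∧
          sumSlope a b m w p ^ 2 + β * (p 1 - g₀ (p 0)) ^ 2 ≤ n}
      · rw [indicator_of_mem hmem, hgN x hx hmem.1]
        simp only [Matrix.cons_val_zero, Matrix.cons_val_one]
        apply le_of_eq; ring
      · rw [indicator_of_notMem hmem]
        simpa using hfid
  · intro x hx t₁ t₂
    by_cases hxS : x ∈ S
    · simp only [calibration_of_mem hxS, Matrix.cons_val_zero]
      exact ⟨(hζ x).intervalIntegrable _ _, hζα x t₁ t₂⟩
    -- Off `S` a vertical line meets the graphs at finitely many heights, and `q` vanishes at all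
    -- others; the second constraint is then void.
    · have hae : (fun t => calibration (sumSlope a b m w) β g₀ N S ζ n !₂[x, t] 0) =ᵐ[volume]
          fun _ => (0 : ℝ) := by
        filter_upwards [(countable_range fun i => leftTrace (w i) x).ae_notMem volume] with t ht
        have hq : sumSlope a b m w !₂[x, t] = 0 := by
          refine sumSlope_eq_zero fun i hi => ht ⟨i, ?_⟩
          exact (eq_leftTrace_of_mem_extGraph hi fun h => hxS (hS i h)).symm
        rw [calibration_of_notMem (by exact hxS), regularField]
        by_cases hmem : !₂[x, t] ∈ {p : Plane | p 0 ∉ N ∧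
          sumSlope a b m w p ^ 2 + β * (p 1 - g₀ (p 0)) ^ 2 ≤ n}
        · rw [indicator_of_mem hmem]
          simp [hq]
        · rw [indicator_of_notMem hmem]
          simp
      constructor
      · exact (intervalIntegrable_const (c := (0 : ℝ))).congr_ae
          (ae_restrict_of_ae (hae.mono fun _ h => h.symm))
      · rw [intervalIntegral.integral_congr_ae (g := fun _ => (0 : ℝ))
          (hae.mono fun _ h _ => h), intervalIntegral.integral_zero, abs_zero]
        exact hα

/-- The part of the graph of `u` over the complement of `S` where the energy is at most `n`. -/
def truncGraph (a b β : ℝ) (g : ℝ → ℝ) (u : ℝ → ℝ) (n : ℕ) : Set Plane :=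
  extGraph a b u ∩ {p | apDeriv u (p 0) ^ 2 + β * (p 1 - g (p 0)) ^ 2 ≤ n}

theorem measurableSet_truncGraph (hab : a < b) {u : ℝ → ℝ} (hu : IsSBV a b u)
    (hfin : (jumpSet a b u).Finite) (β : ℝ) {g : ℝ → ℝ} (hg : Measurable g) (n : ℕ) :
    MeasurableSet (truncGraph a b β g u n) :=
  (measurableSet_extGraph hab hu hfin).inter (measurableSet_le
    ((((measurable_apDeriv u).comp (measurable_coord 0)).pow_const 2).add
      (measurable_fidelity β hg)) measurable_const)

theorem flux_calibration_ae_eq (hab : a < b) (hw : ∀ i, IsSBV a b (w i)) (hm : ∀ i, 0 < m i)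
    (β : ℝ) (g₀ : ℝ → ℝ) {N : Set ℝ} (hN : volume N = 0)
    {S : Finset ℝ} (hS : ∀ i, jumpSet a b (w i) ⊆ S) (ζ : ℝ → ℝ → ℝ) (n : ℕ) (i : ι) :
    flux (calibration (sumSlope a b m w) β g₀ N S ζ n) (graphField a b (w i))
      =ᵐ[(μH[1] : Measure Plane).restrict {p | p 0 ∉ S}]
      (truncGraph a b β g₀ (w i) n).indicator (energyDensity β g₀ (w i)) := by
  filter_upwards [ae_restrict_of_ae (sumSlope_ae_eq hab hw hm hS),
    ae_restrict_of_ae (measure_eq_zero_iff_ae_notMem.1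
      (hausdorff_extGraph_null hab (hw i) (S.finite_toSet.subset (hS i)) hN)),
    ae_restrict_mem (measurableSet_notMem S)] with p hq hpN hpS
  by_cases hpi : p ∈ extGraph a b (w i)
  · have hJ : p 0 ∉ jumpSet a b (w i) := fun h => hpS (hS i h)
    have hN' : p 0 ∉ N := fun h => hpN ⟨hpi, h, hJ⟩
    have hq' := hq hpS i hpi
    rw [flux_graphField_of_mem _ hpi hJ, calibration_of_notMem hpS, regularField]
    by_cases hn : apDeriv (w i) (p 0) ^ 2 + β * (p 1 - g₀ (p 0)) ^ 2 ≤ n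
    · rw [indicator_of_mem (show p ∈ truncGraph a b β g₀ (w i) n from ⟨hpi, hn⟩),
        indicator_of_mem (show p ∈ {p : Plane | p 0 ∉ N ∧ _} from ⟨hN', by rwa [hq']⟩),
        energyDensity, hq']
      simp only [Matrix.cons_val_zero, Matrix.cons_val_one]
      congr 1
      ring
    · rw [indicator_of_notMem (show p ∉ truncGraph a b β g₀ (w i) n from fun h => hn h.2),
        indicator_of_notMem (show p ∉ {p : Plane | p 0 ∉ N ∧ _} from
          fun h => hn (by have := h.2; rwa [hq'] at this))]
      simp
  · rw [flux_graphField_of_notMem _ hpi,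
      indicator_of_notMem (show p ∉ truncGraph a b β g₀ (w i) n from fun h => hpi h.1)]

theorem integrable_truncated_energy (hab : a < b) {u : ℝ → ℝ} (hu : IsSBV a b u)
    (hfin : (jumpSet a b u).Finite) {β : ℝ} (hβ : 0 ≤ β) {g : ℝ → ℝ} (hg : Measurable g) (n : ℕ) :
    Integrable ((truncGraph a b β g u n).indicator (energyDensity β g u)) μH[1] := by
  have hm := measurableSet_truncGraph hab hu hfin β hg n
  rw [integrable_indicator_iff hm]
  refine Measure.integrableOn_of_bounded (M := n)
    ((measure_mono inter_subset_left).trans_lt (hausdorff_extGraph_lt_top hab hu hfin)).ne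
    (measurable_energyDensity β hg u).aestronglyMeasurable ?_
  filter_upwards [ae_restrict_mem hm] with p hp
  rw [Real.norm_of_nonneg (energyDensity_nonneg hβ g u p)]
  refine le_trans (div_le_self (by positivity) ?_) hp.2
  exact Real.one_le_sqrt.2 (by nlinarith [sq_nonneg (apDeriv u (p 0))])

/-- Monotone convergence, valid also when the energy is infinite; the formula for `G` therefore
holds in `[0, +∞]`. -/
theorem tendsto_lintegral_truncated (hab : a < b) {u : ℝ → ℝ} (hu : IsSBV a b u)
    (hfin : (jumpSet a b u).Finite) (β : ℝ) {g : ℝ → ℝ} (hg : Measurable g) (S : Finset ℝ) :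
    Tendsto (fun n : ℕ => ∫⁻ p in {p | p 0 ∉ S}, ENNReal.ofReal
        ((truncGraph a b β g u n).indicator (energyDensity β g u) p) ∂μH[1]) atTop
      (𝓝 (∫⁻ p in extGraph a b u ∩ {p | p 0 ∉ S}, ENNReal.ofReal (energyDensity β g u p)
        ∂μH[1])) := by
  have hmeas := measurableSet_extGraph hab hu hfin
  rw [← Measure.restrict_restrict hmeas, ← lintegral_indicator hmeas]
  have hind : ∀ n p, ENNReal.ofReal ((truncGraph a b β g u n).indicator (energyDensity β g u) p) =
      (truncGraph a b β g u n).indicator (fun p => ENNReal.ofReal (energyDensity β g u p)) p := by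
    intro n p
    by_cases hp : p ∈ truncGraph a b β g u n <;> simp [hp]
  simp_rw [hind]
  refine lintegral_tendsto_of_tendsto_of_monotone (fun n => ?_) (Eventually.of_forall fun p => ?_)
    (Eventually.of_forall fun p => ?_)
  · exact ((measurable_energyDensity β hg u).ennreal_ofReal.indicator
      (measurableSet_truncGraph hab hu hfin β hg n)).aemeasurable
  · intro n k hnk
    have hsub : truncGraph a b β g u n ⊆ truncGraph a b β g u k := fun p hp =>
      ⟨hp.1, le_trans (b := (n : ℝ)) hp.2 (by exact_mod_cast hnk)⟩
    exact indicator_le_indicator_of_subset hsub (fun _ => bot_le) p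
  · refine tendsto_const_nhds.congr' ?_
    obtain ⟨k, hk⟩ := exists_nat_ge (apDeriv u (p 0) ^ 2 + β * (p 1 - g (p 0)) ^ 2)
    filter_upwards [eventually_ge_atTop k] with n hn
    have hkn : apDeriv u (p 0) ^ 2 + β * (p 1 - g (p 0)) ^ 2 ≤ n :=
      hk.trans (by exact_mod_cast hn)
    by_cases hp : p ∈ extGraph a b u
    · rw [indicator_of_mem hp, indicator_of_mem (show p ∈ truncGraph a b β g u n from ⟨hp, hkn⟩)]
    · rw [indicator_of_notMem hp,
        indicator_of_notMem (show p ∉ truncGraph a b β g u n from fun h => hp h.1)]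

/-- The truncated calibrations have integrable flux and realize the truncated energy of every graph
together with the full cost of every jump. Letting `n → ∞` recovers the total energy. The hypothesis
`hchain` provides the densities on the vertical lines. -/
theorem le_fieldLift (hab : a < b) (hw : ∀ i, IsSBV a b (w i)) (hm : ∀ i, 0 < m i) {α β : ℝ}
    (hα : 0 ≤ α) (hβ : 0 ≤ β) {g g₀ : ℝ → ℝ} (hg₀ : Measurable g₀) {N : Set ℝ}
    (hNm : MeasurableSet N) (hN : volume N = 0) (hgN : ∀ x ∈ Ioo a b, x ∉ N → g x = g₀ x)
    {S : Finset ℝ} (hSI : (S : Set ℝ) ⊆ Ioo a b) (hS : ∀ i, jumpSet a b (w i) ⊆ S)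
    (hchain : ∀ y ∈ S, ∀ i j, leftTrace (w i) y ≠ rightTrace (w i) y →
      leftTrace (w j) y ≠ rightTrace (w j) y → leftTrace (w i) y ≠ rightTrace (w j) y) :
    ((∑ i, ENNReal.ofReal (m i) * mumfordShah a b α β g₀ S (w i) : ℝ≥0∞) : EReal) ≤
      fieldLift a b α β g (sumField a b m w) := by
  have hfin := fun i => S.finite_toSet.subset (hS i)
  have hζ' : ∀ y, ∃ ζ : ℝ → ℝ, Continuous ζ ∧ (∀ t₁ t₂, |∫ t in t₁..t₂, ζ t| ≤ α) ∧
      (y ∈ S → ∀ i, ∫ t in (leftTrace (w i) y)..(rightTrace (w i) y), ζ t =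
        if leftTrace (w i) y = rightTrace (w i) y then 0 else α) := by
    intro y
    by_cases hy : y ∈ S
    · obtain ⟨ζ, h1, h2, h3⟩ := exists_jump_density hα _ _ (hchain y hy)
      exact ⟨ζ, h1, h2, fun _ => h3⟩
    · exact ⟨fun _ => 0, continuous_const, by simpa using hα, fun h => absurd h hy⟩
  choose ζ hζ hζα hζv using hζ'
  set φ := fun n : ℕ => calibration (sumSlope a b m w) β g₀ N S ζ n with hφdef
  have hφK : ∀ n, φ n ∈ fieldSet a b α β g := fun n =>
    calibration_mem_fieldSet hab hw hα hβ hg₀ hNm hgN hS hζ hζα n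
  have hφi : ∀ n i, Integrable (flux (φ n) (graphField a b (w i))) μH[1] := by
    intro n i
    refine integrable_of_split S ?_ fun y hy =>
      integrableOn_flux_vertical (hSI hy) ((hφK n).2.2 y (hSI hy) _ _).1
    exact (integrable_truncated_energy hab (hw i) (hfin i) hβ hg₀ n).integrableOn.congr
      (flux_calibration_ae_eq hab hw hm β g₀ hN hS ζ n i).symm
  have hφX : ∀ n, Integrable (flux (φ n) (sumField a b m w)) μH[1] := by
    intro n
    have : flux (φ n) (sumField a b m w) =
        fun p => ∑ i, m i * flux (φ n) (graphField a b (w i)) p :=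
      funext fun p => flux_sumField _ p
    rw [this]
    exact integrable_finsetSum _ fun i _ => (hφi n i).const_mul (m i)
  set Y := ∑ y ∈ S, ∑ i, m i * if leftTrace (w i) y = rightTrace (w i) y then 0 else α
  have hYnn : 0 ≤ Y := Finset.sum_nonneg fun y _ => Finset.sum_nonneg fun i _ =>
    mul_nonneg (hm i).le (by split_ifs <;> simp [hα])
  set X := fun (n : ℕ) i => ∫⁻ p in {p | p 0 ∉ S}, ENNReal.ofReal
        ((truncGraph a b β g₀ (w i) n).indicator (energyDensity β g₀ (w i)) p) ∂μH[1]
  have hval : ∀ n, ((∑ i, ENNReal.ofReal (m i) * X n i) + ENNReal.ofReal Y : ℝ≥0∞) =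
      ENNReal.ofReal (∫ p, flux (φ n) (sumField a b m w) p ∂μH[1]) ∧
      0 ≤ ∫ p, flux (φ n) (sumField a b m w) p ∂μH[1] := by
    intro n
    have hXr : ∀ i, X n i = ENNReal.ofReal (∫ p in {p | p 0 ∉ S},
        flux (φ n) (graphField a b (w i)) p ∂μH[1]) ∧ 0 ≤ ∫ p in {p | p 0 ∉ S},
        flux (φ n) (graphField a b (w i)) p ∂μH[1] := by
      intro i
      have hnn : ∀ p, 0 ≤ (truncGraph a b β g₀ (w i) n).indicator (energyDensity β g₀ (w i)) p :=
        fun p => indicator_nonneg (fun p _ => energyDensity_nonneg hβ g₀ (w i) p) p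
      rw [integral_congr_ae (flux_calibration_ae_eq hab hw hm β g₀ hN hS ζ n i)]
      exact ⟨(ofReal_integral_eq_lintegral_ofReal
        (integrable_truncated_energy hab (hw i) (hfin i) hβ hg₀ n).integrableOn
        (Eventually.of_forall hnn)).symm, integral_nonneg hnn⟩
    have h1 : ∫ p, flux (φ n) (sumField a b m w) p ∂μH[1] =
        (∑ i, m i * ∫ p in {p | p 0 ∉ S}, flux (φ n) (graphField a b (w i)) p ∂μH[1]) + Y := by
      rw [integral_split S (hφX n)]
      congr 1
      · simp_rw [flux_sumField]
        rw [integral_finsetSum _ fun i _ => ((hφi n i).const_mul (m i)).integrableOn]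
        simp_rw [integral_const_mul]
      · refine Finset.sum_congr rfl fun y hy => ?_
        rw [integral_flux_sumField_line (hSI hy) fun t₁ t₂ => ((hφK n).2.2 y (hSI hy) t₁ t₂).1]
        refine Finset.sum_congr rfl fun i _ => ?_
        simp only [hφdef, calibration_of_mem hy, Matrix.cons_val_zero]
        rw [hζv y hy i]
    have h2 := Finset.sum_nonneg fun i (_ : i ∈ Finset.univ) => mul_nonneg (hm i).le (hXr i).2
    refine ⟨?_, h1 ▸ add_nonneg h2 hYnn⟩
    rw [h1, ENNReal.ofReal_add h2 hYnn,
      ENNReal.ofReal_sum_of_nonneg fun i _ => mul_nonneg (hm i).le (hXr i).2]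
    congr 1
    refine Finset.sum_congr rfl fun i _ => ?_
    rw [ENNReal.ofReal_mul (hm i).le, (hXr i).1]
  rw [sum_mumfordShah_eq hα fun i => (hm i).le]
  have hlim : Tendsto (fun n => (∑ i, ENNReal.ofReal (m i) * X n i) + ENNReal.ofReal Y) atTop
      (𝓝 ((∑ i, ENNReal.ofReal (m i) * ∫⁻ p in extGraph a b (w i) ∩ {p | p 0 ∉ S},
        ENNReal.ofReal (energyDensity β g₀ (w i) p) ∂μH[1]) + ENNReal.ofReal Y)) := by
    refine Tendsto.add (tendsto_finsetSum _ fun i _ => ?_) tendsto_const_nhds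
    exact ENNReal.Tendsto.const_mul
      (tendsto_lintegral_truncated hab (hw i) (hfin i) β hg₀ S) (Or.inr ENNReal.ofReal_ne_top)
  refine le_of_tendsto' ((continuous_coe_ennreal_ereal.tendsto _).comp hlim) fun n => ?_
  rw [Function.comp_apply, (hval n).1, EReal.coe_ennreal_ofReal, max_eq_left (hval n).2]
  exact le_iSup₂ (f := fun (φ : Plane → Plane) (_ : φ ∈ {φ ∈ fieldSet a b α β g |
    Integrable (flux φ (sumField a b m w)) μH[1]}) =>
      ((∫ p, flux φ (sumField a b m w) p ∂μH[1] : ℝ) : EReal)) (φ n) ⟨hφK n, hφX n⟩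

theorem G_eq_sum_mumfordShah (hab : a < b) (hw : ∀ i, IsSBV a b (w i)) (hm : ∀ i, 0 < m i)
    {α β : ℝ} (hα : 0 ≤ α) (hβ : 0 ≤ β) {g g₀ : ℝ → ℝ} (hg₀ : Measurable g₀) {N : Set ℝ}
    (hNm : MeasurableSet N) (hN : volume N = 0) (hgN : ∀ x ∈ Ioo a b, x ∉ N → g x = g₀ x)
    {S : Finset ℝ} (hSI : (S : Set ℝ) ⊆ Ioo a b) (hS : ∀ i, jumpSet a b (w i) ⊆ S)
    (hchain : ∀ y ∈ S, ∀ i j, leftTrace (w i) y ≠ rightTrace (w i) y →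
      leftTrace (w j) y ≠ rightTrace (w j) y → leftTrace (w i) y ≠ rightTrace (w j) y) :
    G α β g (∑ i, m i • graphCurrent a b (w i)) =
      ((∑ i, ENNReal.ofReal (m i) * mumfordShah a b α β g₀ S (w i) : ℝ≥0∞) : EReal) := by
  have hfin := fun i => S.finite_toSet.subset (hS i)
  rw [G_sum_graphCurrent hab hw hfin]
  exact le_antisymm (fieldLift_le hab hw hfin (fun i => (hm i).le) hα hβ hg₀ hN hgN hSI hS)
    (le_fieldLift hab hw hm hα hβ hg₀ hNm hN hgN hSI hS hchain)

end Calibration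

/-! ### Pasting along paths -/

section Paste

/-- The number of points of `S` to the left of `x`. -/
def leftIndex (S : Finset ℝ) (x : ℝ) : Fin (S.card + 1) :=
  ⟨(S.filter (· < x)).card, Nat.lt_succ_of_le (Finset.card_filter_le _ _)⟩

/-- The number of points of `S` to the left of `x`, including `x` itself. -/
def rightIndex (S : Finset ℝ) (x : ℝ) : Fin (S.card + 1) :=
  ⟨(S.filter (· ≤ x)).card, Nat.lt_succ_of_le (Finset.card_filter_le _ _)⟩

theorem rightIndex_le_leftIndex {S : Finset ℝ} {x y : ℝ} (h : x < y) :
    rightIndex S x ≤ leftIndex S y :=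
  Finset.card_le_card (Finset.monotone_filter_right S fun _ _ hs => lt_of_le_of_lt hs h)

theorem leftIndex_le_rightIndex (S : Finset ℝ) (x : ℝ) : leftIndex S x ≤ rightIndex S x :=
  Finset.card_le_card (Finset.monotone_filter_right S fun _ _ hs => le_of_lt hs)

theorem leftIndex_lt_rightIndex {S : Finset ℝ} {x : ℝ} (hx : x ∈ S) :
    leftIndex S x < rightIndex S x := by
  refine Finset.card_lt_card (Finset.ssubset_iff_of_subset
    (Finset.monotone_filter_right S fun _ _ hs => le_of_lt hs) |>.2 ⟨x, ?_, ?_⟩)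
  · simp [hx]
  · simp

theorem rightIndex_eq_leftIndex {S : Finset ℝ} {x : ℝ} (hx : x ∉ S) :
    rightIndex S x = leftIndex S x := by
  unfold rightIndex leftIndex
  congr 2
  refine Finset.filter_congr fun s hs => ?_
  have : s ≠ x := fun h => hx (h ▸ hs)
  exact ⟨fun h => lt_of_le_of_ne h this, le_of_lt⟩

theorem eventually_leftIndex_left (S : Finset ℝ) (x : ℝ) :
    ∀ᶠ z in 𝓝[<] x, leftIndex S z = leftIndex S x := by
  have h : ∀ᶠ z in 𝓝[<] x, ∀ s ∈ S, (s < z ↔ s < x) := by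
    refine (Finset.eventually_all S).2 fun s _ => ?_
    filter_upwards [eventually_ite_lt_left s x 1] with z hz
    by_contra h
    by_cases h1 : s < z <;> by_cases h2 : s < x <;> simp_all
  filter_upwards [h] with z hz
  unfold leftIndex
  congr 2
  exact Finset.filter_congr hz

theorem eventually_leftIndex_right (S : Finset ℝ) (x : ℝ) :
    ∀ᶠ z in 𝓝[>] x, leftIndex S z = rightIndex S x := by
  have h : ∀ᶠ z in 𝓝[>] x, ∀ s ∈ S, (s < z ↔ s ≤ x) := by
    refine (Finset.eventually_all S).2 fun s _ => ?_
    filter_upwards [eventually_ite_lt_right s x 1] with z hz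
    by_contra h
    by_cases h1 : s < z <;> by_cases h2 : s ≤ x <;> simp_all
  filter_upwards [h] with z hz
  unfold leftIndex rightIndex
  congr 2
  exact Finset.filter_congr hz

theorem eventually_leftIndex {S : Finset ℝ} {x : ℝ} (hx : x ∉ S) :
    ∀ᶠ z in 𝓝 x, leftIndex S z = leftIndex S x := by
  have h1 := eventually_leftIndex_left S x
  have h2 := eventually_leftIndex_right S x
  rw [rightIndex_eq_leftIndex hx] at h2
  rw [← nhdsNE_sup_pure x, ← nhdsLT_sup_nhdsGT]
  simp [eventually_sup, h1, h2]

variable {a b : ℝ} {k : ℕ}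

/-- The function which follows `u (σ j)` on the `j`-th component of the complement of `S`. -/
def paste (S : Finset ℝ) (u : Fin k → ℝ → ℝ) (σ : Fin (S.card + 1) → Fin k) (x : ℝ) : ℝ :=
  u (σ (leftIndex S x)) x

theorem isPiecewiseAC_paste {S : Finset ℝ} (hSI : (S : Set ℝ) ⊆ Ioo a b) {u : Fin k → ℝ → ℝ}
    (hu : ∀ i, IsPiecewiseAC a b (u i)) (σ : Fin (S.card + 1) → Fin k) :
    IsPiecewiseAC a b (paste S u σ) := by
  -- The number of points of `S` before `x` is at most `S.card`, so the reduction modulo `S.card +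
  -- 1` has no effect on the indices that occur.
  have h := IsPiecewiseAC.paste S hSI (U := fun n => u (σ (Fin.ofNat (S.card + 1) n)))
    fun n => hu _
  convert h using 1
  funext x
  have : Fin.ofNat (S.card + 1) (S.filter (· < x)).card = leftIndex S x :=
    Fin.ext (Nat.mod_eq_of_lt (leftIndex S x).2)
  rw [this]
  rfl

theorem leftTrace_paste (S : Finset ℝ) (u : Fin k → ℝ → ℝ) (σ : Fin (S.card + 1) → Fin k)
    (x : ℝ) : leftTrace (paste S u σ) x = leftTrace (u (σ (leftIndex S x))) x := by
  obtain ⟨c, hc, h⟩ := (mem_nhdsLT_iff_exists_Ioo_subset).1 (eventually_leftIndex_left S x)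
  refine leftTrace_congr hc fun z hz => ?_
  have : leftIndex S z = leftIndex S x := h hz
  rw [paste, this]

theorem rightTrace_paste (S : Finset ℝ) (u : Fin k → ℝ → ℝ) (σ : Fin (S.card + 1) → Fin k)
    (x : ℝ) : rightTrace (paste S u σ) x = rightTrace (u (σ (rightIndex S x))) x := by
  obtain ⟨c, hc, h⟩ := (mem_nhdsGT_iff_exists_Ioo_subset).1 (eventually_leftIndex_right S x)
  refine rightTrace_congr hc fun z hz => ?_
  have : leftIndex S z = rightIndex S x := h hz
  rw [paste, this]

theorem jumpSet_paste_subset {S : Finset ℝ} {u : Fin k → ℝ → ℝ}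
    (hS : ∀ i, jumpSet a b (u i) ⊆ S) (σ : Fin (S.card + 1) → Fin k) :
    jumpSet a b (paste S u σ) ⊆ S := by
  intro x hx
  by_contra hxS
  refine hx.2 ?_
  rw [leftTrace_paste, rightTrace_paste, rightIndex_eq_leftIndex (by simpa using hxS)]
  exact leftTrace_eq_rightTrace_of_notMem hx.1 fun h => hxS (hS _ h)

theorem apDeriv_paste {S : Finset ℝ} (u : Fin k → ℝ → ℝ) (σ : Fin (S.card + 1) → Fin k) {x : ℝ}
    (hx : x ∉ S) : apDeriv (paste S u σ) x = apDeriv (u (σ (leftIndex S x))) x := by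
  refine EventuallyEq.deriv_eq ?_
  filter_upwards [eventually_leftIndex hx, S.finite_toSet.isClosed.isOpen_compl.mem_nhds hx]
    with z hz hzS
  rw [preciseRep, preciseRep, leftTrace_paste, rightTrace_paste, rightIndex_eq_leftIndex hzS, hz]

theorem graphField_paste {S : Finset ℝ} (u : Fin k → ℝ → ℝ) (σ : Fin (S.card + 1) → Fin k)
    {p : Plane} (hp : p 0 ∉ S) :
    graphField a b (paste S u σ) p = graphField a b (u (σ (leftIndex S (p 0)))) p := by
  have hmem : p ∈ extGraph a b (paste S u σ) ↔
      p ∈ extGraph a b (u (σ (leftIndex S (p 0)))) := by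
    simp only [extGraph, mem_ofPred_eq, leftTrace_paste, rightTrace_paste,
      rightIndex_eq_leftIndex hp]
  have hor : graphOrientation (paste S u σ) p =
      graphOrientation (u (σ (leftIndex S (p 0)))) p := by
    simp only [graphOrientation, leftTrace_paste, rightTrace_paste,
      rightIndex_eq_leftIndex hp, apDeriv_paste u σ hp]
  by_cases h : p ∈ extGraph a b (paste S u σ)
  · rw [graphField, graphField, indicator_of_mem h, indicator_of_mem (hmem.1 h), hor]
  · rw [graphField, graphField, indicator_of_notMem h, indicator_of_notMem (h ∘ hmem.2)]

end Paste

/-! ### Weights on paths -/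

section Weights

variable {k n : ℕ}

/-- Non-negative weights on paths whose marginals are all equal to `c`. -/
def pathWeights (n : ℕ) (c : Fin k → ℝ) : Set ((Fin n → Fin k) → ℝ) :=
  {P | (∀ σ, 0 ≤ P σ) ∧ ∀ j i, ∑ σ, P σ * (if σ j = i then 1 else 0) = c i}

theorem sum_pathWeights_smul {E : Type*} [AddCommGroup E] [Module ℝ E] {c : Fin k → ℝ}
    {P : (Fin n → Fin k) → ℝ} (hP : P ∈ pathWeights n c) (j : Fin n) (f : Fin k → E) :
    ∑ σ, P σ • f (σ j) = ∑ i, c i • f i := by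
  simp_rw [← fun i => hP.2 j i, Finset.sum_smul]
  rw [Finset.sum_comm]
  refine Finset.sum_congr rfl fun σ _ => ?_
  simp

/-- A weight is at most the marginal of its first branch. With no components at all (length `0`)
there would be no marginal condition and hence no bound. -/
theorem isCompact_pathWeights (c : Fin k → ℝ) : IsCompact (pathWeights (n + 1) c) := by
  refine (isCompact_Icc (a := (0 : (Fin (n + 1) → Fin k) → ℝ))
    (b := fun σ => c (σ 0))).of_isClosed_subset ?_ ?_
  · have h : pathWeights (n + 1) c = (⋂ σ, {P | 0 ≤ P σ}) ∩
        ⋂ j, ⋂ i, {P | ∑ σ, P σ * (if σ j = i then 1 else 0) = c i} := by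
      ext P
      simp [pathWeights]
    rw [h]
    exact (isClosed_iInter fun σ => isClosed_le continuous_const (continuous_apply σ)).inter
      (isClosed_iInter fun j => isClosed_iInter fun i =>
        isClosed_eq (by fun_prop) continuous_const)
  · intro P hP
    refine ⟨hP.1, fun σ => ?_⟩
    change P σ ≤ c (σ 0)
    rw [← hP.2 0 (σ 0)]
    refine le_trans (by simp) (Finset.single_le_sum
      (f := fun τ => P τ * (if τ 0 = σ 0 then 1 else 0))
      (fun τ _ => mul_nonneg (hP.1 τ) (by split_ifs <;> simp)) (Finset.mem_univ σ))

theorem pathWeights_nonempty {c : Fin k → ℝ} (hc : ∀ i, 0 ≤ c i) :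
    (pathWeights n c).Nonempty := by
  -- The constant paths, weighted by `c`, correspond to the given decomposition.
  refine ⟨fun σ => ∑ i, if σ = (fun _ => i) then c i else 0,
    fun σ => Finset.sum_nonneg fun i _ => by split_ifs <;> simp [hc], fun j i => ?_⟩
  have h : ∀ (σ : Fin n → Fin k) (x : Fin k),
      (if σ = (fun _ => x) then c x else 0) * (if σ j = i then 1 else 0) =
        if σ = (fun _ => x) then (if x = i then c x else 0) else 0 := by
    intro σ x
    by_cases hσ : σ = fun _ => x
    · subst hσ
      simp
    · simp [hσ]
  simp_rw [Finset.sum_mul, h]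
  rw [Finset.sum_comm]
  simp

/-- Follow `σ` up to the index `j₀` and `τ` afterwards. -/
def splice (j₀ : Fin n) (σ τ : Fin n → Fin k) (j : Fin n) : Fin k := if j ≤ j₀ then σ j else τ j

/-- Exchange the mass `δ` of `σ` and `τ` for that of their splices. -/
def exchange (P : (Fin n → Fin k) → ℝ) (δ : ℝ) (j₀ : Fin n) (σ τ : Fin n → Fin k)
    (ρ : Fin n → Fin k) : ℝ :=
  P ρ + δ * ((if ρ = splice j₀ σ τ then 1 else 0) + (if ρ = splice j₀ τ σ then 1 else 0) -
    (if ρ = σ then 1 else 0) - (if ρ = τ then 1 else 0))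

theorem sum_exchange_mul (P : (Fin n → Fin k) → ℝ) (δ : ℝ) (j₀ : Fin n) (σ τ : Fin n → Fin k)
    (f : (Fin n → Fin k) → ℝ) : ∑ ρ, exchange P δ j₀ σ τ ρ * f ρ = ∑ ρ, P ρ * f ρ +
      δ * (f (splice j₀ σ τ) + f (splice j₀ τ σ) - f σ - f τ) := by
  have h : ∀ ρ, exchange P δ j₀ σ τ ρ * f ρ = P ρ * f ρ + δ *
      ((if ρ = splice j₀ σ τ then f ρ else 0) + (if ρ = splice j₀ τ σ then f ρ else 0) -
        (if ρ = σ then f ρ else 0) - (if ρ = τ then f ρ else 0)) := by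
    intro ρ
    unfold exchange
    split_ifs <;> ring
  simp_rw [h]
  rw [Finset.sum_add_distrib, ← Finset.mul_sum]
  simp [Finset.sum_add_distrib, Finset.sum_sub_distrib]

/-- At each index the two splices use the same pair of branches as `σ` and `τ`, so the marginals do
not move. Distinctness of `σ` and `τ` ensures that no path loses more than `δ`. -/
theorem exchange_mem {c : Fin k → ℝ} {P : (Fin n → Fin k) → ℝ} (hP : P ∈ pathWeights n c)
    {δ : ℝ} (hδ : 0 ≤ δ) (j₀ : Fin n) {σ τ : Fin n → Fin k} (hστ : σ ≠ τ) (hσ : δ ≤ P σ)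
    (hτ : δ ≤ P τ) : exchange P δ j₀ σ τ ∈ pathWeights n c := by
  refine ⟨fun ρ => ?_, fun j i => ?_⟩
  · have h1 : ∀ ρ' : Fin n → Fin k, 0 ≤ δ * (if ρ = ρ' then 1 else 0) := fun ρ' =>
      mul_nonneg hδ (by split_ifs <;> simp)
    have h2 : 0 ≤ P ρ - δ * (if ρ = σ then 1 else 0) - δ * (if ρ = τ then 1 else 0) := by
      by_cases hρσ : ρ = σ
      · subst hρσ
        simp [hστ, hσ]
      · by_cases hρτ : ρ = τ
        · subst hρτ
          simp [hρσ, hτ]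
        · simp [hρσ, hρτ, hP.1 ρ]
    unfold exchange
    linarith [h1 (splice j₀ σ τ), h1 (splice j₀ τ σ)]
  · rw [sum_exchange_mul P δ j₀ σ τ fun ρ => if ρ j = i then 1 else 0, hP.2 j i]
    have : (if splice j₀ σ τ j = i then (1 : ℝ) else 0) + (if splice j₀ τ σ j = i then 1 else 0) -
        (if σ j = i then 1 else 0) - (if τ j = i then 1 else 0) = 0 := by
      unfold splice
      by_cases hj : j ≤ j₀
      · simp [hj]
      · simp [hj]
    rw [this, mul_zero, add_zero]

/-- There are weights such that no path jumps at `y ∈ S` from the place where another one jumps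
to. -/
theorem exists_pathWeights_no_chain (S : Finset ℝ) {c : Fin k → ℝ} (hc : ∀ i, 0 ≤ c i)
    (l r : ℝ → Fin k → ℝ) :
    ∃ P ∈ pathWeights (S.card + 1) c, ∀ y ∈ S, ∀ σ τ, 0 < P σ → 0 < P τ →
      l y (σ (leftIndex S y)) ≠ r y (σ (rightIndex S y)) →
      l y (τ (leftIndex S y)) ≠ r y (τ (rightIndex S y)) →
      l y (σ (leftIndex S y)) ≠ r y (τ (rightIndex S y)) := by
  -- `J y σ` detects a jump of the path at `y` and `F` counts all its jumps; the coupling minimizes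
  -- the weighted count.
  let J : ℝ → (Fin (S.card + 1) → Fin k) → ℝ := fun y σ =>
    if l y (σ (leftIndex S y)) = r y (σ (rightIndex S y)) then 0 else 1
  let F : (Fin (S.card + 1) → Fin k) → ℝ := fun σ => ∑ y ∈ S, J y σ
  obtain ⟨P, hP, hmin⟩ := (isCompact_pathWeights (n := S.card) c).exists_isMinOn
    (pathWeights_nonempty hc) (f := fun P => ∑ σ, P σ * F σ)
    (Continuous.continuousOn (by fun_prop))
  refine ⟨P, hP, fun y hy σ τ hσ hτ h1 h2 h3 => ?_⟩
  have hστ : σ ≠ τ := by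
    rintro rfl
    exact h1 h3
  set j₀ := leftIndex S y with hj₀
  have hδ : 0 < min (P σ) (P τ) := lt_min hσ hτ
  have hmem := exchange_mem hP hδ.le j₀ hστ (min_le_left _ _) (min_le_right _ _)
  have hle := hmin hmem
  simp only [mem_ofPred_eq] at hle
  rw [sum_exchange_mul] at hle
  have hR : ¬ rightIndex S y ≤ j₀ := not_le.2 (leftIndex_lt_rightIndex hy)
  -- At another point both traces lie on the same side of the splice, so the two jump indicators are
  -- at most permuted.
  have hother : ∀ s ∈ S, s ≠ y →
      J s (splice j₀ σ τ) + J s (splice j₀ τ σ) - J s σ - J s τ = 0 := by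
    intro s hs hsy
    rcases lt_or_gt_of_ne hsy with hlt | hlt
    · have hRs : rightIndex S s ≤ j₀ := rightIndex_le_leftIndex hlt
      have hLs : leftIndex S s ≤ j₀ := (leftIndex_le_rightIndex S s).trans hRs
      simp only [J, splice, hRs, hLs, if_true]
      ring
    · have hLs : ¬ leftIndex S s ≤ j₀ := not_le.2
        ((leftIndex_lt_rightIndex hy).trans_le (rightIndex_le_leftIndex hlt))
      have hRs : ¬ rightIndex S s ≤ j₀ := fun h => hLs ((leftIndex_le_rightIndex S s).trans h)
      simp only [J, splice, hRs, hLs, if_false]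
      ring
  -- At `y` the splice following `σ` and then `τ` is continuous by `h3`, and the other one has at
  -- most one jump, against two jumps before the exchange.
  have hy' : J y (splice j₀ σ τ) + J y (splice j₀ τ σ) - J y σ - J y τ ≤ -1 := by
    have e1 : J y (splice j₀ σ τ) = 0 := by
      simp only [J, splice, ← hj₀, hR, le_refl, if_true, if_false, h3]
    have e2 : J y (splice j₀ τ σ) ≤ 1 := by
      simp only [J]
      split_ifs <;> simp
    have e3 : J y σ = 1 := if_neg h1
    have e4 : J y τ = 1 := if_neg h2
    rw [e1, e3, e4]
    linarith
  have hF : F (splice j₀ σ τ) + F (splice j₀ τ σ) - F σ - F τ ≤ -1 := by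
    simp only [F]
    rw [← Finset.sum_add_distrib, ← Finset.sum_sub_distrib, ← Finset.sum_sub_distrib,
      Finset.sum_eq_single_of_mem y hy hother]
    exact hy'
  nlinarith

end Weights

/-! ### The decomposition -/

section Decomposition

variable {a b : ℝ} {k : ℕ}

theorem sumField_paste_ae_eq {S : Finset ℝ} (hSI : (S : Set ℝ) ⊆ Ioo a b) {u : Fin k → ℝ → ℝ}
    {c : Fin k → ℝ} {P : (Fin (S.card + 1) → Fin k) → ℝ} (hP : P ∈ pathWeights (S.card + 1) c) :
    sumField a b P (fun σ => paste S u σ) =ᵐ[μH[1]] sumField a b c u := by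
  -- These endpoints of vertical segments are countably many, hence `ℋ¹`-null; away from them the
  -- step function formula for the density applies.
  set D : Set Plane := ⋃ y ∈ S, ⋃ i, {!₂[y, leftTrace (u i) y], !₂[y, rightTrace (u i) y]}
  have hDc : D.Countable := S.countable_toSet.biUnion fun y _ =>
    countable_iUnion fun i => ((countable_singleton _).insert _)
  have hD0 : ∀ᵐ p ∂(μH[1] : Measure Plane), p ∉ D := by
    have := Measure.nullSingletonClass_hausdorff Plane one_pos
    exact hDc.ae_notMem _
  filter_upwards [hD0] with p hp
  by_cases hpS : p 0 ∈ S
  · have hne : ∀ i, p 1 ≠ leftTrace (u i) (p 0) ∧ p 1 ≠ rightTrace (u i) (p 0) := by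
      intro i
      constructor <;> intro h <;> refine hp (mem_iUnion₂.2 ⟨p 0, hpS, mem_iUnion.2 ⟨i, ?_⟩⟩)
      · left; rw [← h, plane_eta]
      · right; rw [← h, plane_eta]; rfl
    have hI := hSI hpS
    have h1 : ∀ i, graphField a b (u i) p = !₂[0, (if leftTrace (u i) (p 0) < p 1 then 1 else 0) -
        (if rightTrace (u i) (p 0) < p 1 then 1 else 0)] := by
      intro i
      rw [← graphField_vertical hI (hne i).1 (hne i).2, plane_eta]
    have h2 : ∀ σ, graphField a b (paste S u σ) p =
        !₂[0, (if leftTrace (u (σ (leftIndex S (p 0)))) (p 0) < p 1 then 1 else 0) -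
        (if rightTrace (u (σ (rightIndex S (p 0)))) (p 0) < p 1 then 1 else 0)] := by
      intro σ
      have := graphField_vertical (u := paste S u σ) (t := p 1) hI
        (by rw [leftTrace_paste]; exact (hne _).1) (by rw [rightTrace_paste]; exact (hne _).2)
      rw [leftTrace_paste, rightTrace_paste, plane_eta] at this
      exact this
    have h3 := sum_pathWeights_smul hP (leftIndex S (p 0))
      fun i => if leftTrace (u i) (p 0) < p 1 then (1 : ℝ) else 0
    have h4 := sum_pathWeights_smul hP (rightIndex S (p 0))
      fun i => if rightTrace (u i) (p 0) < p 1 then (1 : ℝ) else 0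
    simp only [sumField, h1, h2]
    ext j
    fin_cases j
    · simp
    · simp only [smul_eq_mul] at h3 h4
      have key : ∑ σ, P σ *
          ((if leftTrace (u (σ (leftIndex S (p 0)))) (p 0) < p 1 then (1 : ℝ) else 0) -
          (if rightTrace (u (σ (rightIndex S (p 0)))) (p 0) < p 1 then 1 else 0)) =
          ∑ i, c i * ((if leftTrace (u i) (p 0) < p 1 then 1 else 0) -
          (if rightTrace (u i) (p 0) < p 1 then 1 else 0)) := by
        simp only [mul_sub, Finset.sum_sub_distrib, h3, h4]
      simpa using key
  · simp only [sumField, graphField_paste u _ hpS]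
    exact sum_pathWeights_smul hP (leftIndex S (p 0)) fun i => graphField a b (u i) p

theorem coe_ennreal_sum {ι : Type*} (s : Finset ι) (f : ι → ℝ≥0∞) :
    ((∑ i ∈ s, f i : ℝ≥0∞) : EReal) = ∑ i ∈ s, (f i : EReal) := by
  classical
  induction s using Finset.induction_on with
  | empty => simp
  | insert i s hi ih => rw [Finset.sum_insert hi, Finset.sum_insert hi, EReal.coe_ennreal_add, ih]

theorem exists_convex_decomposition (a b : ℝ) (hab : a < b) (α β : ℝ) (hα : 0 < α) (hβ : 0 ≤ β)
    (g : ℝ → ℝ)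
    (hg : MemLp g ⊤ (volume.restrict (Ioo a b)))
    (k : ℕ) (c : Fin k → ℝ) (hc : ∀ i, 0 ≤ c i)
    (u : Fin k → ℝ → ℝ) (hu : ∀ i, IsSBV a b (u i))
    (hS : (⋃ i, jumpSet a b (u i)).Finite) :
    ∃ (k' : ℕ) (m : Fin k' → ℝ) (w : Fin k' → ℝ → ℝ),
      (∀ i, 0 < m i) ∧ (∀ i, IsSBV a b (w i)) ∧
      ∑ i, c i • graphCurrent a b (u i)
        = ∑ i, m i • graphCurrent a b (w i) ∧
      G α β g (∑ i, c i • graphCurrent a b (u i))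
        = ∑ i, (m i : EReal) * G α β g (graphCurrent a b (w i)) := by
  classical
  set S := hS.toFinset
  have hSu : ∀ i, jumpSet a b (u i) ⊆ S := fun i => by
    rw [hS.coe_toFinset]
    exact subset_iUnion (fun i => jumpSet a b (u i)) i
  have hSI : (S : Set ℝ) ⊆ Ioo a b := by
    rw [hS.coe_toFinset]
    exact iUnion_subset fun i x hx => hx.1
  have hfinu := fun i => S.finite_toSet.subset (hSu i)
  have hpac : ∀ σ, IsPiecewiseAC a b (paste S u σ) :=
    isPiecewiseAC_paste hSI fun i => (hu i).isPiecewiseAC hab (hfinu i)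
  have hsbv := fun σ => (hpac σ).isSBV hab
  have hSw := fun σ => jumpSet_paste_subset (a := a) (b := b) hSu σ
  obtain ⟨P, hP, hchain⟩ := exists_pathWeights_no_chain S hc
    (fun y i => leftTrace (u i) y) (fun y i => rightTrace (u i) y)
  -- Only charged paths are kept: the coefficients have to be positive, and the no-chain property
  -- concerns these paths alone.
  let e := (Fintype.equivFin {σ // 0 < P σ}).symm
  -- The constraint defining `fieldSet` uses `g` pointwise, but `g` is only almost everywhere
  -- measurable. The calibration uses a measurable version and vanishes over a measurable null set
  -- `N`, off `S`, containing every point of the interval where the two differ.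
  obtain ⟨N, hNm, hN, hgN⟩ : ∃ N : Set ℝ, MeasurableSet N ∧ volume N = 0 ∧
      ∀ x ∈ Ioo a b, x ∉ N → g x = hg.1.mk g x := by
    have h0 := hg.1.ae_eq_mk
    rw [Filter.EventuallyEq, ae_restrict_iff' measurableSet_Ioo] at h0
    refine ⟨toMeasurable volume {x | ¬ (x ∈ Ioo a b → g x = hg.1.mk g x)},
      measurableSet_toMeasurable _ _, by rw [measure_toMeasurable]; exact h0, fun x hx hxN => ?_⟩
    by_contra h
    exact hxN (subset_toMeasurable _ _ fun h' => h (h' hx))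
  have hg₀ : Measurable (hg.1.mk g) := hg.1.stronglyMeasurable_mk.measurable
  have hT : ∑ i, c i • graphCurrent a b (u i) =
      ∑ i, P (e i) • graphCurrent a b (paste S u (e i).1) := by
    have h1 : ∑ i, P (e i) • graphCurrent a b (paste S u (e i).1) =
        ∑ σ, P σ • graphCurrent a b (paste S u σ) := by
      rw [e.sum_comp fun σ : {σ // 0 < P σ} => P σ • graphCurrent a b (paste S u σ.1),
        ← Finset.sum_filter_of_ne (p := fun σ => 0 < P σ)]
      · exact (Finset.sum_subtype _ (by simp) fun σ => P σ • graphCurrent a b (paste S u σ)).symm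
      · intro σ _ hne
        exact lt_of_le_of_ne (hP.1 σ) fun h => hne (by rw [← h, zero_smul])
    rw [h1]
    funext ω
    rw [sum_graphCurrent_eq_integral hab hu hfinu, sum_graphCurrent_eq_integral hab hsbv
      fun σ => S.finite_toSet.subset (hSw σ)]
    refine integral_congr_ae ?_
    filter_upwards [sumField_paste_ae_eq hSI (u := u) hP] with p hp
    rw [hp]
  refine ⟨_, fun i => P (e i), fun i => paste S u (e i).1, fun i => (e i).2,
    fun i => hsbv _, hT, ?_⟩
  have hG : ∀ σ, G α β g (graphCurrent a b (paste S u σ)) =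
      ((mumfordShah a b α β (hg.1.mk g) S (paste S u σ) : ℝ≥0∞) : EReal) := by
    intro σ
    -- For a single function the no-chain condition only says that a jump has distinct endpoints.
    have h1 := G_eq_sum_mumfordShah (ι := Unit) (m := fun _ => 1) (w := fun _ => paste S u σ) hab
      (fun _ => hsbv σ) (fun _ => one_pos) hα.le hβ hg₀ hNm hN hgN hSI (fun _ => hSw σ)
      (fun y _ _ _ h _ => h)
    simpa using h1
  rw [hT, G_eq_sum_mumfordShah hab (fun i => hsbv (e i).1) (fun i => (e i).2) hα.le hβ hg₀ hNm hN
    hgN hSI (fun i => hSw (e i).1) ?_, coe_ennreal_sum]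
  · refine Finset.sum_congr rfl fun i _ => ?_
    rw [hG, EReal.coe_ennreal_mul, EReal.coe_ennreal_ofReal, max_eq_left (e i).2.le]
  · intro y hy i j
    simp only [leftTrace_paste, rightTrace_paste]
    exact hchain y hy _ _ (e i).2 (e j).2

end Decomposition

end MumfordShah

end

theorem mainTheorem1 (a b : ℝ) (hab : a < b) (α β : ℝ) (hα : 0 < α) (hβ : 0 ≤ β)
    (g : ℝ → ℝ)
    (hg : MeasureTheory.MemLp g ⊤ (MeasureTheory.volume.restrict (Set.Ioo a b)))
    (k : ℕ) (c : Fin k → ℝ) (hc : ∀ i, 0 ≤ c i)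
    (u : Fin k → ℝ → ℝ) (hu : ∀ i, MumfordShah.IsSBV a b (u i))
    (hS : (⋃ i, MumfordShah.jumpSet a b (u i)).Finite) :
    ∃ (k' : ℕ) (m : Fin k' → ℝ) (w : Fin k' → ℝ → ℝ),
      (∀ i, 0 < m i) ∧ (∀ i, MumfordShah.IsSBV a b (w i)) ∧
      ∑ i, c i • MumfordShah.graphCurrent a b (u i)
        = ∑ i, m i • MumfordShah.graphCurrent a b (w i) ∧
      MumfordShah.G α β g (∑ i, c i • MumfordShah.graphCurrent a b (u i))
        = ∑ i, (m i : EReal) * MumfordShah.G α β g (MumfordShah.graphCurrent a b (w i)) := by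
  exact MumfordShah.exists_convex_decomposition a b hab α β hα hβ g hg k c hc u hu hS
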